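/- Let $X$ be a complex manifold (for instance the analytic manifold of a smooth complex projective variety), let $f:X\to\mathbb P^1$ be a holomorphic map, and let $D\subset X$ be a divisor with normal crossings such that $f$ takes values in $\mathbb C$ on $U=X\setminus D$. Let $P=f^{-1}(\infty)=\sum_i e_iP_i$ be the pole divisor of $f$, whose support is contained in $D$. For $\mu\in\mathbb R$ put $[\mu P]=\sum_i[\mu e_i]P_i$, where $[\cdot]$ is the integral part, and $\Omega^k_X(\log D)([\mu P])=\mathcal O_X([\mu P])\otimes\Omega^k_X(\log D)$; let $\Omega^k_X(\log D)([\mu P])_+$ be this sheaf if $\mu\ge 0$, and $0$ if $\mu<0$. Let $\nabla=d+df$ and $$\Omega^k_f([\mu P])=\ker\Big(\Omega^k_X(\log D)([\mu P])\xrightarrow{\,df\wedge\,}\Omega^{k+1}_X(\log D)([(\mu+1)P])\big/\Omega^{k+1}_X(\log D)([\mu P])\Big).$$ Consider the following graded sheaves, all contained in $j_*\Omega^\bullet_U$ with $j:U\hookrightarrow X$ the inclusion: - $\Omega_f^\bullet(\mu)$, with $\Omega^k_f([\mu P])$ in degree $k$, and its stupid filtration $\sigma^p$ (keep the degrees $k\ge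 p$), $p\in\mathbb Z$; - for $\lambda\in\mathbb R$, $F^0(\lambda)$, with $\Omega^k_X(\log D)([(k-\lambda)P])$ in degree $k$; - on $F^0(-\mu)$, the filtration $\tau^p$ equal to $F^0(-\mu)$ for $p\le 0$ and, for $p\ge 0$, with $\Omega^k_X(\log D)([(k-p+\mu)P])$ in degree $k\ge p$ and $0$ in degree $k<p$; - for $\lambda\in\mathbb R$, $F^\lambda(\nabla)$, with $\Omega^k_X(\log D)([(k-\lambda)P])_+$ in degree $k$; - for $\alpha\in[0,1)$ and $p\in\mathbb Z$, Yu's irregular Hodge filtration $F^{\mathrm{Yu},p}_\alpha=F^{-\alpha+p}(\nabla)$ and, on $F^0(\nabla)$, the filtration $F^p_\alpha$ equal to $F^0(\nabla)$ for $p\le 0$ and to $F^{-\alpha+p}(\nabla)$ for $p\ge 1$. An inclusion of $\mathbb Z$-filtered complexes of sheaves of $\mathbb C$-vector spaces is called a filtered quasi-isomorphism if for every $p$ it induces a quasi-isomorphism (that is, isomorphisms on the cohomology of all stalks) both between the $p$-th steps of the filtrations and between the $p$-th graded pieces. Then: 1. For every $\mu\in\mathbb R$, $\sigma^p$ and $\tau^p$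 are decreasing filtrations by subcomplexes for $\nabla$, and the natural inclusion $(\Omega_f^\bullet(\mu),\nabla,\sigma^p)\to(F^0(-\mu),\nabla,\tau^p)$ is a filtered quasi-isomorphism. The same holds when $\nabla$ is replaced by $df\wedge$ in both complexes. 2. For every $\alpha\in[0,1)$, the natural inclusions $$(\Omega_f^\bullet(\alpha),\nabla,\sigma^p)\to(F^0(\nabla),F^p_\alpha)\to F^{\mathrm{Yu},p}_\alpha(\Omega^\bullet_X(*D),\nabla)\qquad(p\in\mathbb Z)$$ are filtered quasi-isomorphisms of filtered complexes for $\nabla$. Here $\Omega_X^\bullet(*D)$ (forms with arbitrary poles along $D$) is stable by $\nabla$ and contains every $F^{\mathrm{Yu},p}_\alpha$. -/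

import Mathlib

open CategoryTheory CategoryTheory.Limits Filter Topology
open scoped Manifold ContDiff

namespace KontsevichYu

noncomputable section

/-! ### Filtered complexes and filtered quasi-isomorphisms -/

section FilteredComplexes

variable {M : ℕ → Type} [∀ k, AddCommGroup (M k)] [∀ k, Module ℂ (M k)]
  (δ : ∀ k, M k →ₗ[ℂ] M (k + 1)) (hδ : ∀ k (x : M k), δ (k + 1) (δ k x) = 0)

/-- A graded subspace of the complex `(M, δ)` which is stable by the differential. -/
def IsSubcomplex (A : ∀ k, Submodule ℂ (M k)) : Prop :=
  ∀ k, ∀ x ∈ A k, δ k x ∈ A (k + 1)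

/-- A subcomplex of `(M, δ)`, as a cochain complex of complex vector spaces. -/
def subcomplex (A : ∀ k, Submodule ℂ (M k)) (hA : IsSubcomplex δ A) :
    CochainComplex (ModuleCat.{0} ℂ) ℕ :=
  CochainComplex.of (fun k => ModuleCat.of ℂ (A k))
    (fun k => ModuleCat.ofHom ((δ k).restrict (hA k)))
    (fun k => by
      ext x
      exact congrArg (Subtype.val) (Subtype.ext (hδ k x.1) : (⟨δ (k + 1) (δ k x.1), _⟩ : A (k + 1 + 1)) = 0))

/-- The inclusion between two nested subcomplexes of `(M, δ)`. -/
def inclusion {A B : ∀ k, Submodule ℂ (M k)} (hA : IsSubcomplex δ A) (hB : IsSubcomplex δ B)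
    (hAB : ∀ k, A k ≤ B k) : subcomplex δ hδ A hA ⟶ subcomplex δ hδ B hB :=
  CochainComplex.ofHom (fun k => ModuleCat.ofHom (Submodule.inclusion (hAB k)))
    (fun k => by
      simp only [subcomplex, CochainComplex.of_d]
      rfl)

/-- A decreasing filtration, indexed by `ℤ`, by subcomplexes of `(M, δ)`. -/
structure IsFiltration (A : ℤ → ∀ k, Submodule ℂ (M k)) : Prop where
  isSubcomplex : ∀ p, IsSubcomplex δ (A p)
  antitone : ∀ p q, p ≤ q → ∀ k, A q k ≤ A p k

variable {A B : ℤ → ∀ k, Submodule ℂ (M k)}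

/-- The inclusion of the step `p + 1` of a decreasing filtration in the step `p`. -/
def stepInclusion (hA : IsFiltration δ A) (p : ℤ) :
    subcomplex δ hδ (A (p + 1)) (hA.isSubcomplex (p + 1)) ⟶
      subcomplex δ hδ (A p) (hA.isSubcomplex p) :=
  inclusion δ hδ _ _ (hA.antitone p (p + 1) (by lia))

/-- The graded piece `gr^p = A^p / A^{p+1}` of a filtration by subcomplexes. -/
def gr (hA : IsFiltration δ A) (p : ℤ) : CochainComplex (ModuleCat.{0} ℂ) ℕ :=
  cokernel (stepInclusion δ hδ hA p)

/-- The morphism induced on the graded pieces by an inclusion of filtered complexes. -/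
def grMap (hA : IsFiltration δ A) (hB : IsFiltration δ B) (hAB : ∀ p k, A p k ≤ B p k) (p : ℤ) :
    gr δ hδ hA p ⟶ gr δ hδ hB p :=
  cokernel.map (stepInclusion δ hδ hA p) (stepInclusion δ hδ hB p)
    (inclusion δ hδ (hA.isSubcomplex (p + 1)) (hB.isSubcomplex (p + 1)) (hAB (p + 1)))
    (inclusion δ hδ (hA.isSubcomplex p) (hB.isSubcomplex p) (hAB p))
    rfl

variable (A B) in
/-- `A^p ⊆ B^p` (`p ∈ ℤ`) are decreasing filtrations by subcomplexes of `(M, δ)`, and the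
inclusion is a filtered quasi-isomorphism: it induces quasi-isomorphisms `A^p → B^p` and
`gr_A^p → gr_B^p` for every `p`. -/
def IsFilteredQuasiIso : Prop :=
  ∃ (hA : IsFiltration δ A) (hB : IsFiltration δ B) (hAB : ∀ p k, A p k ≤ B p k),
    ∀ p : ℤ,
      QuasiIso (inclusion δ hδ (hA.isSubcomplex p) (hB.isSubcomplex p) (hAB p)) ∧
      QuasiIso (grMap δ hδ hA hB hAB p)

end FilteredComplexes

/-! ### Exterior product by a `1`-form -/

section Wedge

variable {E : Type*} [NormedAddCommGroup E] [NormedSpace ℂ E] {k : ℕ}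

/-- The exterior product `a ∧ w` of a `1`-form and a `k`-form, normalised as in `extDeriv`:
`(a ∧ w)(v_0, …, v_k) = ∑ (-1)^i a(v_i) w(v_0, …, v_i omitted, …, v_k)`. -/
def wedge (a : E →L[ℂ] ℂ) (w : E [⋀^Fin k]→L[ℂ] ℂ) : E [⋀^Fin (k + 1)]→L[ℂ] ℂ :=
  ContinuousAlternatingMap.alternatizeUncurryFin (a.smulRight w)

theorem wedge_eq (a : E →L[ℂ] ℂ) (w : E [⋀^Fin k]→L[ℂ] ℂ) :
    wedge a w = ContinuousAlternatingMap.alternatizeUncurryFinCLM ℂ E ℂ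
      (ContinuousLinearMap.smulRightL ℂ E (E [⋀^Fin k]→L[ℂ] ℂ) a w) := rfl

theorem wedge_wedge (a : E →L[ℂ] ℂ) (w : E [⋀^Fin k]→L[ℂ] ℂ) :
    wedge a (wedge a w) = 0 := by
  rw [← ContinuousAlternatingMap.alternatizeUncurryFin_alternatizeUncurryFinCLM_comp_of_symmetric
    (f := a.smulRight (a.smulRight w)) (fun x y => by
      simp only [ContinuousLinearMap.smulRight_apply, smul_apply]
      rw [smul_comm])]
  simp only [wedge]
  congr 1
  ext v : 1
  simp

theorem hasFDerivAt_smulRight {G : Type*} [NormedAddCommGroup G] [NormedSpace ℂ G]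
    {a : E → E →L[ℂ] ℂ} {η : E → G} {a' : E →L[ℂ] E →L[ℂ] ℂ} {η' : E →L[ℂ] G} {z : E}
    (ha : HasFDerivAt a a' z) (hη : HasFDerivAt η η' z) :
    ∃ L : E →L[ℂ] E →L[ℂ] G, HasFDerivAt (fun z => (a z).smulRight (η z)) L z ∧
      ∀ x y, L x y = a z y • η' x + a' x y • η z := by
  refine ⟨_, (ContinuousLinearMap.smulRightL ℂ E G).hasFDerivAt_of_bilinear ha hη, ?_⟩
  intro x y
  simp

theorem analyticAt_smulRight {G : Type*} [NormedAddCommGroup G] [NormedSpace ℂ G]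
    {a : E → E →L[ℂ] ℂ} {η : E → G} {z : E}
    (ha : AnalyticAt ℂ a z) (hη : AnalyticAt ℂ η z) :
    AnalyticAt ℂ (fun z => (a z).smulRight (η z)) z :=
  ((ContinuousLinearMap.smulRightL ℂ E G).analyticAt_bilinear (a z, η z)).comp₂ ha hη

theorem analyticAt_alternatize {η : E → E →L[ℂ] E [⋀^Fin k]→L[ℂ] ℂ} {z : E}
    (h : AnalyticAt ℂ η z) :
    AnalyticAt ℂ (fun z => ContinuousAlternatingMap.alternatizeUncurryFin (η z)) z := by
  have g : AnalyticAt ℂ (fun u : E →L[ℂ] E [⋀^Fin k]→L[ℂ] ℂ =>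
      ContinuousAlternatingMap.alternatizeUncurryFin u) (η z) :=
    @ContinuousLinearMap.analyticAt ℂ _ (E →L[ℂ] E [⋀^Fin k]→L[ℂ] ℂ) _ _
      (E [⋀^Fin (k + 1)]→L[ℂ] ℂ) _ _
      (ContinuousAlternatingMap.alternatizeUncurryFinCLM ℂ E ℂ (n := k)) (η z)
  exact g.comp h

theorem analyticAt_extDeriv {η : E → E [⋀^Fin k]→L[ℂ] ℂ} {z : E}
    (h : AnalyticAt ℂ η z) : AnalyticAt ℂ (extDeriv η) z :=
  analyticAt_alternatize h.fderiv

theorem analyticAt_wedge {F : E → ℂ} {η : E → E [⋀^Fin k]→L[ℂ] ℂ}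
    {z : E} (hF : AnalyticAt ℂ F z) (h : AnalyticAt ℂ η z) :
    AnalyticAt ℂ (fun z => wedge (fderiv ℂ F z) (η z)) z :=
  analyticAt_alternatize (analyticAt_smulRight hF.fderiv h)

theorem extDeriv_wedge_add {F : E → ℂ} {η : E → E [⋀^Fin k]→L[ℂ] ℂ}
    {z : E} (hF : AnalyticAt ℂ F z) (hη : AnalyticAt ℂ η z) :
    extDeriv (fun z => wedge (fderiv ℂ F z) (η z)) z
      + wedge (fderiv ℂ F z) (extDeriv η z) = 0 := by
  have h₁ : HasFDerivAt (fderiv ℂ F) (fderiv ℂ (fderiv ℂ F) z) z :=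
    hF.fderiv.differentiableAt.hasFDerivAt
  have h₂ : HasFDerivAt η (fderiv ℂ η z) z := hη.differentiableAt.hasFDerivAt
  obtain ⟨L, hL, hL'⟩ := hasFDerivAt_smulRight h₁ h₂
  have h₄ : fderiv ℂ (fun z => wedge (fderiv ℂ F z) (η z)) z =
      (ContinuousAlternatingMap.alternatizeUncurryFinCLM ℂ E ℂ (n := k)).comp L :=
    ((ContinuousAlternatingMap.alternatizeUncurryFinCLM ℂ E ℂ
      (n := k)).hasFDerivAt.comp z hL).fderiv
  have hs : IsSymmSndFDerivAt ℂ F z := hF.contDiffAt.isSymmSndFDerivAt (n := ω) (by simp)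
  simp only [extDeriv, wedge] at h₄ ⊢
  rw [h₄, ← ContinuousAlternatingMap.alternatizeUncurryFin_add,
    ← ContinuousAlternatingMap.alternatizeUncurryFin_alternatizeUncurryFinCLM_comp_of_symmetric
    (f := L + (fderiv ℂ F z).smulRight (fderiv ℂ η z)) (fun x y => by
      simp [hL', hs.eq x y]
      abel)]
  congr 1
  ext v : 1
  simp

end Wedge

/-! ### Germs of differential forms on the complement of coordinate hyperplanes -/

/-- Constant-coefficient `k`-forms on `ℂⁿ`. -/
abbrev Form (n k : ℕ) : Type := (Fin n → ℂ) [⋀^Fin k]→L[ℂ] ℂ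

variable {n : ℕ}

/-- The complement in `ℂⁿ` of the coordinate hyperplanes `z_i = 0`, `i ∈ S`. -/
def offHyperplanes (S : Finset (Fin n)) : Set (Fin n → ℂ) := {z | ∀ i ∈ S, z i ≠ 0}

/-- The filter of neighbourhoods of the origin in the complement of the coordinate hyperplanes
`z_i = 0`, `i ∈ S`. -/
def nhdsOff (S : Finset (Fin n)) : Filter (Fin n → ℂ) := 𝓝[offHyperplanes S] 0

theorem isOpen_offHyperplanes (S : Finset (Fin n)) : IsOpen (offHyperplanes S) := by
  have : offHyperplanes S = ⋂ i ∈ S, {z : Fin n → ℂ | z i ≠ 0} := by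
    ext z; simp [offHyperplanes]
  rw [this]
  exact isOpen_biInter_finset fun i _ => isOpen_ne_fun (continuous_apply i) continuous_const

theorem eventually_nhdsOff_nhds {S : Finset (Fin n)} {p : (Fin n → ℂ) → Prop}
    (h : ∀ᶠ z in nhdsOff S, p z) : ∀ᶠ z in nhdsOff S, ∀ᶠ w in 𝓝 z, p w := by
  filter_upwards [eventually_eventually_nhdsWithin.2 h, eventually_mem_nhdsWithin] with z hz hzS
  rwa [(isOpen_offHyperplanes S).nhdsWithin_eq hzS] at hz

/-- The exterior derivative on germs at the origin of forms defined off the coordinate hyperplanes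
`z_i = 0`, `i ∈ S`. -/
def dGerm (S : Finset (Fin n)) (k : ℕ) (γ : Germ (nhdsOff S) (Form n k)) :
    Germ (nhdsOff S) (Form n (k + 1)) :=
  Germ.map' extDeriv (fun _ _ h => (eventually_nhdsOff_nhds h).mono fun _ hz =>
    EventuallyEq.extDeriv_eq hz) γ

/-- The left multiplication by `dF` on germs of forms. -/
def dfGerm (S : Finset (Fin n)) (F : (Fin n → ℂ) → ℂ) (k : ℕ)
    (γ : Germ (nhdsOff S) (Form n k)) : Germ (nhdsOff S) (Form n (k + 1)) :=
  Germ.map₂ wedge (↑(fderiv ℂ F) : Germ (nhdsOff S) ((Fin n → ℂ) →L[ℂ] ℂ)) γ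

/-- Germs at the origin of holomorphic `k`-forms defined off the coordinate hyperplanes
`z_i = 0`, `i ∈ S` (with no condition along these hyperplanes). -/
def HolForms (S : Finset (Fin n)) (k : ℕ) : Submodule ℂ (Germ (nhdsOff S) (Form n k)) where
  carrier := {γ | ∃ η : (Fin n → ℂ) → Form n k,
    (η : Germ (nhdsOff S) (Form n k)) = γ ∧ ∀ᶠ z in nhdsOff S, AnalyticAt ℂ η z}
  zero_mem' := ⟨0, rfl, Eventually.of_forall fun _ => analyticAt_const⟩
  add_mem' := by
    rintro _ _ ⟨η, rfl, hη⟩ ⟨θ, rfl, hθ⟩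
    exact ⟨η + θ, rfl, (hη.and hθ).mono fun z h => h.1.add h.2⟩
  smul_mem' := by
    rintro c _ ⟨η, rfl, hη⟩
    exact ⟨c • η, rfl, hη.mono fun z h => h.const_smul⟩

/-- The operator `u d + v dF ∧` on germs of holomorphic forms defined off the coordinate hyperplanes
`z_i = 0`, `i ∈ S`. For `u = v = 1` this is `∇ = d + dF`, and for `u = 0`, `v = 1` it is `dF ∧`. -/
def twistedD (S : Finset (Fin n)) (F : (Fin n → ℂ) → ℂ) (hF : ∀ᶠ z in nhdsOff S, AnalyticAt ℂ F z)
    (u v : ℂ) (k : ℕ) : HolForms S k →ₗ[ℂ] HolForms S (k + 1) where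
  toFun γ := ⟨u • dGerm S k γ.1 + v • dfGerm S F k γ.1, by
    obtain ⟨_, η, rfl, hη⟩ := γ
    exact ⟨u • extDeriv η + v • fun z => wedge (fderiv ℂ F z) (η z), rfl,
      (hη.and hF).mono fun z h =>
        (analyticAt_extDeriv h.1).const_smul.add (analyticAt_wedge h.2 h.1).const_smul⟩⟩
  map_add' := by
    rintro ⟨_, η, rfl, hη⟩ ⟨_, θ, rfl, hθ⟩
    refine Subtype.ext (Germ.coe_eq.2 ?_)
    filter_upwards [hη, hθ] with z h₁ h₂
    change u • extDeriv (η + θ) z + v • wedge (fderiv ℂ F z) (η z + θ z) =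
      (u • extDeriv η z + v • wedge (fderiv ℂ F z) (η z)) +
        (u • extDeriv θ z + v • wedge (fderiv ℂ F z) (θ z))
    rw [extDeriv_add h₁.differentiableAt h₂.differentiableAt]
    simp only [wedge_eq, map_add, smul_add]
    abel
  map_smul' := by
    rintro c ⟨_, η, rfl, hη⟩
    refine Subtype.ext (Germ.coe_eq.2 ?_)
    filter_upwards [hη] with z h₁
    change u • extDeriv (c • η) z + v • wedge (fderiv ℂ F z) (c • η z) =
      c • (u • extDeriv η z + v • wedge (fderiv ℂ F z) (η z))
    rw [extDeriv_smul]
    simp only [wedge_eq, map_smul, smul_add, smul_comm c]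

theorem twistedD_twistedD (S : Finset (Fin n)) (F : (Fin n → ℂ) → ℂ)
    (hF : ∀ᶠ z in nhdsOff S, AnalyticAt ℂ F z) (u v : ℂ) (k : ℕ) (γ : HolForms S k) :
    twistedD S F hF u v (k + 1) (twistedD S F hF u v k γ) = 0 := by
  obtain ⟨_, η, rfl, hη⟩ := γ
  refine Subtype.ext (Germ.coe_eq.2 ?_)
  filter_upwards [hη, hF] with z h₁ h₂
  have hd := (analyticAt_extDeriv h₁).differentiableAt
  have hw := (analyticAt_wedge h₂ h₁).differentiableAt
  have hdd : extDeriv (extDeriv η) z = 0 :=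
    extDeriv_extDeriv_apply (r := ω) h₁.contDiffAt (by simp)
  have hdw := extDeriv_wedge_add h₂ h₁
  change u • extDeriv (u • extDeriv η + v • fun z => wedge (fderiv ℂ F z) (η z)) z +
    v • wedge (fderiv ℂ F z) (u • extDeriv η z + v • wedge (fderiv ℂ F z) (η z)) = 0
  rw [extDeriv_add (hd.const_smul u) (hw.const_smul v), extDeriv_smul, extDeriv_smul, hdd]
  simp only [wedge_eq, map_add, map_smul]
  simp only [← wedge_eq]
  rw [wedge_wedge, eq_neg_of_add_eq_zero_left hdw]
  simp only [smul_zero, zero_add, add_zero, smul_neg, smul_comm v u]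
  exact neg_add_cancel _

/-! ### Logarithmic forms with poles -/

/-- The logarithmic frame of vector fields: `z_i ∂/∂z_i` for `i ∈ S` and `∂/∂z_i` for `i ∉ S`.
It is dual to the coframe `dz_i / z_i` (`i ∈ S`), `dz_i` (`i ∉ S`). -/
def logFrame (S : Finset (Fin n)) (z : Fin n → ℂ) (i : Fin n) : Fin n → ℂ :=
  Pi.single i (if i ∈ S then z i else 1)

/-- The stalk at the origin of `Ω^k(log D)(∑ m_i D_i)`, where `D = ⋃_{i ∈ S} D_i` and
`D_i = {z_i = 0}`: the germs `η` such that `(∏_{i ∈ S} z_i ^ m_i) η` is a combination, with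
coefficients holomorphic at the origin, of exterior products of the `dz_i / z_i` (`i ∈ S`) and the
`dz_i` (`i ∉ S`). These coefficients are the values on the vectors of the dual frame `logFrame`. -/
def logForms (S : Finset (Fin n)) (m : Fin n → ℤ) (k : ℕ) : Submodule ℂ (HolForms S k) where
  carrier := {γ | ∃ η : (Fin n → ℂ) → Form n k, (η : Germ (nhdsOff S) (Form n k)) = γ.1 ∧
    ∀ J : Fin k → Fin n, ∃ c : (Fin n → ℂ) → ℂ, AnalyticAt ℂ c 0 ∧
      ∀ᶠ z in nhdsOff S, (∏ i ∈ S, z i ^ m i) * η z (fun a => logFrame S z (J a)) = c z}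
  zero_mem' := ⟨0, rfl, fun _ => ⟨0, analyticAt_const, Eventually.of_forall fun _ => by simp⟩⟩
  add_mem' := by
    rintro ⟨_, h₁⟩ ⟨_, h₂⟩ ⟨η, rfl, hη⟩ ⟨θ, rfl, hθ⟩
    refine ⟨η + θ, rfl, fun J => ?_⟩
    obtain ⟨a, ha, ha'⟩ := hη J
    obtain ⟨b, hb, hb'⟩ := hθ J
    refine ⟨a + b, ha.add hb, ?_⟩
    filter_upwards [ha', hb'] with z h h'
    simp [← h, ← h', mul_add]
  smul_mem' := by
    rintro t ⟨_, h₁⟩ ⟨η, rfl, hη⟩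
    refine ⟨t • η, rfl, fun J => ?_⟩
    obtain ⟨a, ha, ha'⟩ := hη J
    refine ⟨t • a, ha.const_smul, ?_⟩
    filter_upwards [ha'] with z h
    simp [← h, mul_left_comm]

/-- The stalk at the origin of `Ω^k(*D)`, where `D = ⋃_{i ∈ S} {z_i = 0}`: the germs of forms which
become holomorphic at the origin after multiplication by a power of `∏_{i ∈ S} z_i`. -/
def meroForms (S : Finset (Fin n)) (k : ℕ) : Submodule ℂ (HolForms S k) where
  carrier := {γ | ∃ η : (Fin n → ℂ) → Form n k, (η : Germ (nhdsOff S) (Form n k)) = γ.1 ∧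
    ∃ (N : ℕ) (θ : (Fin n → ℂ) → Form n k), AnalyticAt ℂ θ 0 ∧
      ∀ᶠ z in nhdsOff S, (∏ i ∈ S, z i) ^ N • η z = θ z}
  zero_mem' := ⟨0, rfl, 0, 0, analyticAt_const, Eventually.of_forall fun _ => by simp⟩
  add_mem' := by
    rintro ⟨_, h₁⟩ ⟨_, h₂⟩ ⟨η, rfl, N, a, ha, ha'⟩ ⟨θ, rfl, N', b, hb, hb'⟩
    have hp : ∀ j : ℕ, AnalyticAt ℂ (fun z : Fin n → ℂ => (∏ i ∈ S, z i) ^ j) 0 := fun j =>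
      (Finset.analyticAt_fun_prod S fun i _ =>
        (ContinuousLinearMap.proj (R := ℂ) (φ := fun _ : Fin n => ℂ) i).analyticAt 0).pow j
    refine ⟨η + θ, rfl, N + N', _, ((hp N').smul ha).add ((hp N).smul hb), ?_⟩
    filter_upwards [ha', hb'] with z h h'
    change _ • (η z + θ z) = (∏ i ∈ S, z i) ^ N' • a z + (∏ i ∈ S, z i) ^ N • b z
    rw [← h, ← h', smul_smul, smul_smul, smul_add, pow_add, mul_comm]
  smul_mem' := by
    rintro t ⟨_, h₁⟩ ⟨η, rfl, N, a, ha, ha'⟩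
    refine ⟨t • η, rfl, N, t • a, ha.const_smul, ?_⟩
    filter_upwards [ha'] with z h
    change _ • (t • η z) = t • a z
    rw [← h, smul_comm]

section Filtrations

/-! In this section the pole divisor is `P = ∑ e_i D_i`, with `D_i = {z_i = 0}`. All objects are
stalks at the origin. -/

variable (S : Finset (Fin n)) (e : Fin n → ℕ)

/-- `Ω^k(log D)([μP])`, where `[μP] = ∑ [μ e_i] D_i`. -/
def logP (μ : ℝ) (k : ℕ) : Submodule ℂ (HolForms S k) :=
  logForms S (fun i => ⌊μ * (e i : ℝ)⌋) k

/-- `Ω^k(log D)([μP])_+`, which is `Ω^k(log D)([μP])` if `μ ≥ 0` and zero otherwise. -/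
def logPPlus (μ : ℝ) (k : ℕ) : Submodule ℂ (HolForms S k) :=
  open Classical in if 0 ≤ μ then logP S e μ k else ⊥

variable (F : (Fin n → ℂ) → ℂ) (hF : ∀ᶠ z in nhdsOff S, AnalyticAt ℂ F z)

/-- `Ω_f^k([μP])`, the kernel of
`df : Ω^k(log D)([μP]) → Ω^{k+1}(log D)([(μ+1)P]) / Ω^{k+1}(log D)([μP])`. -/
def kontsevich (μ : ℝ) (k : ℕ) : Submodule ℂ (HolForms S k) :=
  logP S e μ k ⊓ (logP S e μ (k + 1)).comap (twistedD S F hF 0 1 k)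

/-- The stupid filtration `σ^p` of the complex `Ω_f^•(μ)`. -/
def sigma (μ : ℝ) (p : ℤ) (k : ℕ) : Submodule ℂ (HolForms S k) :=
  if p ≤ (k : ℤ) then kontsevich S e F hF μ k else ⊥

/-- The complex `F^0(lam)`, with `Ω^k(log D)([(k - lam)P])` in degree `k`. -/
def F0 (lam : ℝ) (k : ℕ) : Submodule ℂ (HolForms S k) := logP S e ((k : ℝ) - lam) k

/-- The filtration `τ^p` of `F^0(-μ)`: it is `F^0(-μ)` if `p ≤ 0`, and, if `p ≥ 0`, the complex
`Ω^p(log D)([μP]) → Ω^{p+1}(log D)([(1+μ)P]) → ⋯` starting in degree `p`. -/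
def tau (μ : ℝ) (p : ℤ) (k : ℕ) : Submodule ℂ (HolForms S k) :=
  if p ≤ 0 then F0 S e (-μ) k
  else if p ≤ (k : ℤ) then logP S e ((k : ℝ) - (p : ℝ) + μ) k else ⊥

/-- The complex `F^lam(∇)`, with `Ω^k(log D)([(k - lam)P])_+` in degree `k`. -/
def FYu (lam : ℝ) (k : ℕ) : Submodule ℂ (HolForms S k) := logPPlus S e ((k : ℝ) - lam) k

/-- The filtration `F_α^p` of the complex `F^0(∇)`: it is `F^0(∇)` if `p ≤ 0`, and `F^{-α+p}(∇)`
if `p ≥ 1`. -/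
def truncatedFYu (α : ℝ) (p : ℤ) (k : ℕ) : Submodule ℂ (HolForms S k) :=
  if p ≤ 0 then FYu S e 0 k else FYu S e (-α + (p : ℝ)) k

/-- The irregular Hodge filtration `F_α^{Yu,p} = F^{-α+p}(∇)`. -/
def irregularHodge (α : ℝ) (p : ℤ) (k : ℕ) : Submodule ℂ (HolForms S k) :=
  FYu S e (-α + (p : ℝ)) k

end Filtrations

/-! ### The geometric setting

All complexes below are complexes of subsheaves of the sheaves `j_* Ω^k_U` on the complex manifold
`X`, where `j : U = X ∖ D → X` is the inclusion. A morphism of complexes of sheaves is a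
quasi-isomorphism when it is so on all stalks, and the stalks at `x` are computed in a chart centred
at `x` which is adapted to `D`: the stalk of `j_* Ω^k_U` is then `HolForms S k`. -/

section Geometry

variable (n) {X : Type*} [TopologicalSpace X] [ChartedSpace (Fin n → ℂ) X]

/-- The coordinate `t` of the chart `ℂ = ℙ¹ ∖ {∞}` (with the irrelevant value `0` at `∞`). -/
def coordT (p : OnePoint ℂ) : ℂ := p.elim 0 id

/-- The coordinate `t' = 1/t` of the chart `ℙ¹ ∖ {0}`, vanishing at `∞` (with the irrelevant
value `0` at `0`). -/
def coordT' (p : OnePoint ℂ) : ℂ := p.elim 0 fun t => t⁻¹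

/-- Holomorphic maps from the complex manifold `X` to the projective line `ℙ¹ = ℂ ∪ {∞}`. -/
structure IsHolomorphicToP1 (f : X → OnePoint ℂ) : Prop where
  continuous : Continuous f
  contMDiffAt_coordT : ∀ x, f x ≠ OnePoint.infty →
    ContMDiffAt 𝓘(ℂ, Fin n → ℂ) 𝓘(ℂ, ℂ) ω (fun y => coordT (f y)) x
  contMDiffAt_coordT' : ∀ x, f x ≠ ((0 : ℂ) : OnePoint ℂ) →
    ContMDiffAt 𝓘(ℂ, Fin n → ℂ) 𝓘(ℂ, ℂ) ω (fun y => coordT' (f y)) x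

/-- A holomorphic chart of `X` centred at `x` in which `D` is a union of coordinate hyperplanes
`z_i = 0`, `i ∈ S`. -/
structure NCChart (D : Set X) (x : X) where
  chart : OpenPartialHomeomorph X (Fin n → ℂ)
  mem_maximalAtlas : chart ∈ IsManifold.maximalAtlas 𝓘(ℂ, Fin n → ℂ) ω X
  mem_source : x ∈ chart.source
  map_eq_zero : chart x = 0
  S : Finset (Fin n)
  mem_iff : ∀ y ∈ chart.source, y ∈ D ↔ ∃ i ∈ S, chart y i = 0

/-- `D` is (the support of) a reduced divisor with normal crossings. -/
def IsNormalCrossing (D : Set X) : Prop := ∀ x, Nonempty (NCChart n D x)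

variable {n} {D : Set X} {x : X} (c : NCChart n D x) (f : X → OnePoint ℂ)

/-- The function `f`, off `f⁻¹(∞)`, in the coordinates of the chart. -/
def NCChart.localF (z : Fin n → ℂ) : ℂ := coordT (f (c.chart.symm z))

/-- The function `1/f`, off `f⁻¹(0)`, in the coordinates of the chart. -/
def NCChart.localInvF (z : Fin n → ℂ) : ℂ := coordT' (f (c.chart.symm z))

/-- The multiplicity `e_i` of the pole divisor `P = f⁻¹(∞)` along the hyperplane `z_i = 0` near
the centre `x` of the chart: if `f x = ∞`, it is the greatest `m` such that `z_i ^ m` divides the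
holomorphic germ `1/f`; if `f x ≠ ∞`, then `P` is empty near `x` and it is zero. -/
def NCChart.mult (i : Fin n) : ℕ :=
  open Classical in
  if f x = OnePoint.infty then
    sSup {m : ℕ | ∃ g : (Fin n → ℂ) → ℂ, AnalyticAt ℂ g 0 ∧
      ∀ᶠ z in 𝓝 0, c.localInvF f z = z i ^ m * g z}
  else 0

theorem NCChart.analyticAt_localF (hf : IsHolomorphicToP1 n f)
    (hfD : ∀ y, y ∉ D → f y ≠ OnePoint.infty) :
    ∀ᶠ z in nhdsOff c.S, AnalyticAt ℂ (c.localF f) z := by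
  have h0 : (0 : Fin n → ℂ) ∈ c.chart.target := c.map_eq_zero ▸ c.chart.map_source c.mem_source
  filter_upwards [mem_nhdsWithin_of_mem_nhds (c.chart.open_target.mem_nhds h0),
    eventually_mem_nhdsWithin] with z hz hzS
  have hD : c.chart.symm z ∉ D := by
    rw [c.mem_iff _ (c.chart.map_target hz), c.chart.right_inv hz]
    rintro ⟨i, hi, h⟩
    exact hzS i hi h
  have h₁ := hf.contMDiffAt_coordT _ (hfD _ hD)
  have h₂ : ContMDiffAt 𝓘(ℂ, Fin n → ℂ) 𝓘(ℂ, Fin n → ℂ) ω c.chart.symm z :=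
    (contMDiffOn_symm_of_mem_maximalAtlas c.mem_maximalAtlas).contMDiffAt
      (c.chart.open_target.mem_nhds hz)
  exact (h₁.comp z h₂).contDiffAt.analyticAt

/-- The operator `u d + v df ∧` on the stalk at `x` of the sheaf of holomorphic forms on `X ∖ D`,
in the coordinates of the chart. -/
def NCChart.diff (hf : IsHolomorphicToP1 n f) (hfD : ∀ y, y ∉ D → f y ≠ OnePoint.infty)
    (u v : ℂ) (k : ℕ) : HolForms c.S k →ₗ[ℂ] HolForms c.S (k + 1) :=
  twistedD c.S (c.localF f) (c.analyticAt_localF f hf hfD) u v k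

theorem NCChart.diff_diff (hf : IsHolomorphicToP1 n f)
    (hfD : ∀ y, y ∉ D → f y ≠ OnePoint.infty) (u v : ℂ) (k : ℕ) (γ : HolForms c.S k) :
    c.diff f hf hfD u v (k + 1) (c.diff f hf hfD u v k γ) = 0 :=
  twistedD_twistedD _ _ _ u v k γ

/-- `A^p ⊆ B^p` (`p ∈ ℤ`) are filtrations by subcomplexes for the differential `u d + v df ∧`, and
the inclusion is a filtered quasi-isomorphism (on the stalks at `x`). -/
def NCChart.IsFilteredQuasiIso (hf : IsHolomorphicToP1 n f)
    (hfD : ∀ y, y ∉ D → f y ≠ OnePoint.infty) (u v : ℂ)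
    (A B : ℤ → ∀ k, Submodule ℂ (HolForms c.S k)) : Prop :=
  KontsevichYu.IsFilteredQuasiIso (M := fun k => HolForms c.S k)
    (c.diff f hf hfD u v) (c.diff_diff f hf hfD u v) A B

end Geometry

end

end KontsevichYu

namespace KontsevichYu

noncomputable section

/-! ### A criterion for filtered quasi-isomorphisms -/

section QuasiIsoCriterion

/-! The question is local, and the only delicate points are those of the pole divisor. There `1/f`
is a holomorphic germ vanishing only on coordinate hyperplanes contained in `D`, hence a unit times
a monomial `z^e` (`exists_unit_mul_monomial`). So `f = w z^{-e}` with `w` a unit and some `e_i ≠ 0`.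
For such an `i` the logarithmic field `X = z_i ∂/∂z_i` satisfies `X f = z^{-e} (X w - e_i w)`, again
a unit times `z^{-e}` because `X` vanishes at the origin (`hasLogPole_of_eq`).

Contraction by `X`, divided by `X f`, is then a homotopy between the identity and zero for `df ∧`,
and it lowers the poles by exactly `P`; on the other hand `d` does not increase the poles of
logarithmic forms. Write `L_a` for the forms with poles in `[aP]`. As `[(a+1)e_i] = [a e_i] + e_i`,
a form in `L_{a+1}` whose differential is in `L_{b+1}`, `a ≤ b`, is the differential of a form in
`L_a` plus a form in `L_b`. This holds for every operator `u d + df ∧`, so `∇` and `df ∧` are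
treated together. The property is isolated in `HasPoleReduction`.

The rest is formal. Each inclusion `A^p ⊆ B^p` is a quasi-isomorphism because `B^p / A^p` is
acyclic: a class is pushed into `A^p` by repeated pole reduction. The graded pieces follow by
comparing long exact sequences. Away from the poles of `f` one has `e = 0`, and all the filtrations
are the stupid filtration of the logarithmic complex. -/

theorem quasiIso_f_of_acyclic {C ι : Type*} [Category* C] [Abelian C] {c : ComplexShape ι}
    {S : ShortComplex (HomologicalComplex C c)} (hS : S.ShortExact) (h : S.X₃.Acyclic) :
    QuasiIso S.f := by
  rw [quasiIso_iff]
  intro j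
  rw [quasiIsoAt_iff_isIso_homologyMap]
  have hz : ∀ i, IsZero (S.X₃.homology i) := fun i => (h i).isZero_homology
  have : Epi (HomologicalComplex.homologyMap S.f j) :=
    (hS.homology_exact₂ j).epi_f ((hz j).eq_of_tgt _ _)
  have : Mono (HomologicalComplex.homologyMap S.f j) := by
    -- When no degree precedes `j` there is no connecting morphism, and injectivity on homology
    -- comes directly from that of the map.
    by_cases hj : ∃ i, c.Rel i j
    · obtain ⟨i, hij⟩ := hj
      exact (hS.homology_exact₁ i j hij).mono_g ((hz i).eq_of_src _ _)
    · have := hS.mono_f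
      push Not at hj
      exact HomologicalComplex.mono_homologyMap_of_mono_of_not_rel S.f j hj
  exact isIso_of_mono_of_epi _

variable {M : ℕ → Type} [∀ k, AddCommGroup (M k)] [∀ k, Module ℂ (M k)]
  (δ : ∀ k, M k →ₗ[ℂ] M (k + 1)) (hδ : ∀ k (x : M k), δ (k + 1) (δ k x) = 0)

/-- The quotient of the complex `B` by its subcomplex `A` is acyclic. -/
def QuotientExact (A B : ∀ k, Submodule ℂ (M k)) : Prop :=
  (∀ x ∈ B 0, δ 0 x ∈ A 1 → x ∈ A 0) ∧
    ∀ k, ∀ x ∈ B (k + 1), δ (k + 1) x ∈ A (k + 2) → ∃ y ∈ B k, x - δ k y ∈ A (k + 1)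

variable {A B : ∀ k, Submodule ℂ (M k)}

instance mono_inclusion (hA : IsSubcomplex δ A) (hB : IsSubcomplex δ B)
    (hAB : ∀ k, A k ≤ B k) : Mono (inclusion δ hδ hA hB hAB) := by
  have : ∀ k, Mono ((inclusion δ hδ hA hB hAB).f k) := fun k =>
    (ModuleCat.mono_iff_injective (ModuleCat.ofHom (Submodule.inclusion (hAB k)))).2
      (Submodule.inclusion_injective (hAB k))
  exact HomologicalComplex.mono_of_mono_f _ this

theorem subcomplex_d_apply (hA : IsSubcomplex δ A) (k : ℕ) (x : A k) :
    ((subcomplex δ hδ A hA).d k (k + 1)).hom x = (⟨δ k x.1, hA k _ x.2⟩ : A (k + 1)) := by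
  simp only [subcomplex, CochainComplex.of_d]
  rfl

theorem acyclic_cokernel_inclusion (hA : IsSubcomplex δ A) (hB : IsSubcomplex δ B)
    (hAB : ∀ k, A k ≤ B k) (h : QuotientExact δ A B) :
    (cokernel (inclusion δ hδ hA hB hAB)).Acyclic := by
  set i := inclusion δ hδ hA hB hAB
  have hex : (ShortComplex.mk i (cokernel.π i) (cokernel.condition i)).ShortExact :=
    { exact := ShortComplex.exact_cokernel i, mono_f := inferInstance, epi_g := inferInstance }
  have hexk : ∀ k, ∀ y : B k, ((cokernel.π i).f k).hom y = 0 → (y : M k) ∈ A k := by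
    intro k y hy
    have h1 := (hex.map_of_exact (HomologicalComplex.eval (ModuleCat.{0} ℂ) _ k)).exact
    rw [ShortComplex.moduleCat_exact_iff] at h1
    obtain ⟨x, hx⟩ := h1 y hy
    have h2 : Submodule.inclusion (hAB k) x = y := hx
    rw [← h2]
    exact (show A k from x).2
  have hsurj : ∀ k, Function.Surjective ((cokernel.π i).f k).hom := fun k =>
    (ModuleCat.epi_iff_surjective _).1 inferInstance
  have hπi : ∀ k (x : A k), ((cokernel.π i).f k).hom (⟨x, hAB k x.2⟩ : B k) = 0 := by
    intro k x
    have := congrArg (fun φ => (φ.f k).hom x) (cokernel.condition i)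
    exact this
  have hcomm : ∀ k (y : B k),
      ((cokernel i).d k (k + 1)).hom (((cokernel.π i).f k).hom y) =
        ((cokernel.π i).f (k + 1)).hom (⟨δ k y.1, hB k _ y.2⟩ : B (k + 1)) := by
    intro k y
    have := congrArg (fun φ => φ.hom y) ((cokernel.π i).comm k (k + 1))
    rw [← subcomplex_d_apply δ hδ hB]
    exact this
  intro k
  cases k with
  | zero =>
    rw [HomologicalComplex.exactAt_iff' _ 0 0 1 (by simp) (by simp),
      ShortComplex.moduleCat_exact_iff]
    intro z hz
    obtain ⟨y, rfl⟩ := hsurj 0 z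
    have hz' := (hcomm 0 y).symm.trans hz
    have hy := h.1 y.1 y.2 (hexk _ _ hz')
    refine ⟨0, ?_⟩
    rw [map_zero]
    exact (hπi 0 ⟨y.1, hy⟩).symm
  | succ k =>
    rw [HomologicalComplex.exactAt_iff' _ k (k + 1) (k + 2) (by simp) (by simp),
      ShortComplex.moduleCat_exact_iff]
    intro z hz
    obtain ⟨(y : B (k + 1)), rfl⟩ := hsurj (k + 1) z
    have hz' := (hcomm (k + 1) y).symm.trans hz
    obtain ⟨x, hx, hxy⟩ := h.2 k y.1 y.2 (hexk _ _ hz')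
    refine ⟨((cokernel.π i).f k).hom (⟨x, hx⟩ : B k), (hcomm k ⟨x, hx⟩).trans ?_⟩
    have h3 := hπi (k + 1) ⟨_, hxy⟩
    have h4 : (⟨y.1 - δ k x, hAB _ hxy⟩ : B (k + 1)) = y - ⟨δ k x, hB k _ hx⟩ := rfl
    rw [h4] at h3
    have h5 := (map_sub ((cokernel.π i).f (k + 1)).hom y (⟨δ k x, hB k _ hx⟩ : B (k + 1)))
    exact (sub_eq_zero.1 (h5.symm.trans h3)).symm

theorem quasiIso_inclusion (hA : IsSubcomplex δ A) (hB : IsSubcomplex δ B)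
    (hAB : ∀ k, A k ≤ B k) (h : QuotientExact δ A B) :
    QuasiIso (inclusion δ hδ hA hB hAB) :=
  quasiIso_f_of_acyclic (S := ShortComplex.mk _ _ (cokernel.condition _))
    { exact := ShortComplex.exact_cokernel _, mono_f := mono_inclusion .., epi_g := inferInstance }
    (acyclic_cokernel_inclusion δ hδ hA hB hAB h)

/-- Only the steps of the filtrations need to be examined: `gr^p` is the third term of a short exact
sequence whose first two terms are the steps `p + 1` and `p`. -/
theorem isFilteredQuasiIso_of_quotientExact {A B : ℤ → ∀ k, Submodule ℂ (M k)}
    (hA : IsFiltration δ A) (hB : IsFiltration δ B) (hAB : ∀ p k, A p k ≤ B p k)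
    (h : ∀ p, QuotientExact δ (A p) (B p)) : IsFilteredQuasiIso δ hδ A B := by
  refine ⟨hA, hB, hAB, fun p => ⟨quasiIso_inclusion δ hδ _ _ _ (h p), ?_⟩⟩
  have hex : ∀ {A : ℤ → ∀ k, Submodule ℂ (M k)} (hA : IsFiltration δ A),
      (ShortComplex.mk (stepInclusion δ hδ hA p) (cokernel.π _)
        (cokernel.condition _)).ShortExact := fun hA =>
    { exact := ShortComplex.exact_cokernel _, mono_f := mono_inclusion .., epi_g := inferInstance }
  let φ : ShortComplex.mk (stepInclusion δ hδ hA p) (cokernel.π _) (cokernel.condition _) ⟶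
      ShortComplex.mk (stepInclusion δ hδ hB p) (cokernel.π _) (cokernel.condition _) :=
    { τ₁ := inclusion δ hδ (hA.isSubcomplex (p + 1)) (hB.isSubcomplex (p + 1)) (hAB (p + 1))
      τ₂ := inclusion δ hδ (hA.isSubcomplex p) (hB.isSubcomplex p) (hAB p)
      τ₃ := grMap δ hδ hA hB hAB p
      comm₁₂ := rfl
      comm₂₃ := (cokernel.π_desc _ _ _).symm }
  exact HomologicalComplex.HomologySequence.quasiIso_τ₃ φ (hex hA) (hex hB)
    (quasiIso_inclusion δ hδ _ _ _ (h _)) (quasiIso_inclusion δ hδ _ _ _ (h _))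

end QuasiIsoCriterion


/-! ### Contraction and the Koszul homotopy -/

section Contraction

variable {E : Type*} [NormedAddCommGroup E] [NormedSpace ℂ E] {k : ℕ}

theorem wedge_apply (a : E →L[ℂ] ℂ) (w : E [⋀^Fin k]→L[ℂ] ℂ) (v : Fin (k + 1) → E) :
    wedge a w v = ∑ i : Fin (k + 1), (-1) ^ i.val • (a (v i) * w (i.removeNth v)) := by
  rw [wedge, ContinuousAlternatingMap.alternatizeUncurryFin_apply]
  rfl

theorem curryLeft_wedge_zero (a : E →L[ℂ] ℂ) (w : E [⋀^Fin 0]→L[ℂ] ℂ) (v : E) :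
    (wedge a w).curryLeft v = a v • w := by
  ext u
  rw [ContinuousAlternatingMap.curryLeft_apply_apply, wedge_apply]
  simp

/-- Contraction is an antiderivation. In the expansion of `a ∧ w` on `(v, u)` the first term is `a v
* w u`, and the others cancel against the second summand, the shift of the index by one changing the
sign. -/
theorem curryLeft_wedge_add_wedge_curryLeft (a : E →L[ℂ] ℂ) (w : E [⋀^Fin (k + 1)]→L[ℂ] ℂ)
    (v : E) : (wedge a w).curryLeft v + wedge a (w.curryLeft v) = a v • w := by
  ext u
  change (wedge a w).curryLeft v u + wedge a (w.curryLeft v) u = a v * w u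
  rw [ContinuousAlternatingMap.curryLeft_apply_apply, wedge_apply, wedge_apply,
    Fin.sum_univ_succ, add_assoc, ← Finset.sum_add_distrib]
  have h0 : (0 : Fin (k + 1 + 1)).removeNth (Matrix.vecCons v u : Fin (k + 2) → E) = u := by
    ext i; simp [Fin.removeNth]
  have hs : ∀ j : Fin (k + 1), (j.succ).removeNth (Matrix.vecCons v u : Fin (k + 2) → E) =
      Matrix.vecCons v (j.removeNth u) := by
    intro j
    ext i
    refine Fin.cases ?_ (fun i => ?_) i <;> simp [Fin.removeNth]
  simp only [h0, hs, ContinuousAlternatingMap.curryLeft_apply_apply]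
  rw [Finset.sum_eq_zero]
  · simp
  · intro j _
    simp [pow_succ]

theorem analyticAt_clm_apply {G H K : Type*} [NormedAddCommGroup G] [NormedSpace ℂ G]
    [NormedAddCommGroup H] [NormedSpace ℂ H] [NormedAddCommGroup K] [NormedSpace ℂ K]
    {a : G → H →L[ℂ] K} {V : G → H} {z : G} (ha : AnalyticAt ℂ a z) (hV : AnalyticAt ℂ V z) :
    AnalyticAt ℂ (fun z => a z (V z)) z :=
  ((ContinuousLinearMap.id ℂ (H →L[ℂ] K)).analyticAt_bilinear (a z, V z)).comp₂ ha hV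

theorem analyticAt_curryLeft {G : Type*} [NormedAddCommGroup G] [NormedSpace ℂ G]
    {η : G → E [⋀^Fin (k + 1)]→L[ℂ] ℂ} {V : G → E} {z : G}
    (hη : AnalyticAt ℂ η z) (hV : AnalyticAt ℂ V z) :
    AnalyticAt ℂ (fun z => (η z).curryLeft (V z)) z := by
  have h := @ContinuousLinearMap.analyticAt ℂ _ (E [⋀^Fin (k + 1)]→L[ℂ] ℂ) _ _
    (E →L[ℂ] E [⋀^Fin k]→L[ℂ] ℂ) _ _
    (ContinuousAlternatingMap.curryLeftLI (𝕜 := ℂ) (E := E) (F := ℂ)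
      (n := k)).toContinuousLinearMap (η z)
  exact analyticAt_clm_apply (h.comp (f := η) (x := z) hη) hV

end Contraction

/-! ### Functions with poles along coordinate hyperplanes -/

section LogFun

variable {n : ℕ} {S : Finset (Fin n)}

/-- `b` is a section of `𝒪(∑ m_i D_i)` near the origin: `(∏_{i ∈ S} z_i ^ m_i) b` extends
holomorphically. -/
def LogFun (S : Finset (Fin n)) (m : Fin n → ℤ) (b : (Fin n → ℂ) → ℂ) : Prop :=
  ∃ c : (Fin n → ℂ) → ℂ, AnalyticAt ℂ c 0 ∧
    ∀ᶠ z in nhdsOff S, (∏ i ∈ S, z i ^ m i) * b z = c z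

variable {m m' : Fin n → ℤ} {b b' : (Fin n → ℂ) → ℂ}

theorem eventually_mem_offHyperplanes : ∀ᶠ z in nhdsOff S, z ∈ offHyperplanes S :=
  eventually_mem_nhdsWithin

theorem eventually_nhdsOff_of_nhds {p : (Fin n → ℂ) → Prop} (h : ∀ᶠ z in 𝓝 0, p z) :
    ∀ᶠ z in nhdsOff S, p z :=
  mem_nhdsWithin_of_mem_nhds h

theorem analyticAt_coord (i : Fin n) (z : Fin n → ℂ) :
    AnalyticAt ℂ (fun z : Fin n → ℂ => z i) z :=
  (ContinuousLinearMap.proj (R := ℂ) (φ := fun _ : Fin n => ℂ) i).analyticAt z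

theorem analyticAt_logFrame (i : Fin n) (z : Fin n → ℂ) :
    AnalyticAt ℂ (fun z => logFrame S z i) z := by
  have h := (ContinuousLinearMap.single ℂ (fun _ : Fin n => ℂ) i).analyticAt
    (if i ∈ S then z i else 1)
  refine h.comp (f := fun z : Fin n → ℂ => if i ∈ S then z i else 1) (x := z) ?_
  by_cases hi : i ∈ S
  · simpa [hi] using analyticAt_coord i z
  · simpa [hi] using analyticAt_const

theorem LogFun.congr (h : LogFun S m b) (hb : b' =ᶠ[nhdsOff S] b) : LogFun S m b' := by
  obtain ⟨c, hc, h⟩ := h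
  refine ⟨c, hc, ?_⟩
  filter_upwards [h, hb] with z h hb
  rw [hb, h]

theorem LogFun.of_analyticAt (h : AnalyticAt ℂ b 0) : LogFun S 0 b :=
  ⟨b, h, Eventually.of_forall fun z => by simp⟩

theorem logFun_zero : LogFun S m 0 := ⟨0, analyticAt_const, Eventually.of_forall fun z => by simp⟩

theorem LogFun.add (h : LogFun S m b) (h' : LogFun S m b') :
    LogFun S m (fun z => b z + b' z) := by
  obtain ⟨c, hc, h⟩ := h
  obtain ⟨c', hc', h'⟩ := h'
  refine ⟨_, hc.add hc', ?_⟩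
  filter_upwards [h, h'] with z h h'
  rw [mul_add, h, h']
  rfl

theorem LogFun.mul (h : LogFun S m b) (h' : LogFun S m' b') :
    LogFun S (m + m') (fun z => b z * b' z) := by
  obtain ⟨c, hc, h⟩ := h
  obtain ⟨c', hc', h'⟩ := h'
  refine ⟨_, hc.mul hc', ?_⟩
  filter_upwards [h, h', eventually_mem_offHyperplanes] with z h h' hz
  simp only [Pi.add_apply]
  rw [Pi.mul_apply, ← h, ← h', Finset.prod_congr rfl fun i hi => zpow_add₀ (hz i hi) (m i) (m' i),
    Finset.prod_mul_distrib]
  ring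

theorem LogFun.const_mul (t : ℂ) (h : LogFun S m b) : LogFun S m (fun z => t * b z) := by
  simpa using (LogFun.of_analyticAt (S := S) (analyticAt_const (v := t))).mul h

theorem LogFun.sum {ι : Type*} {T : Finset ι} {b : ι → (Fin n → ℂ) → ℂ}
    (h : ∀ i ∈ T, LogFun S m (b i)) : LogFun S m (fun z => ∑ i ∈ T, b i z) := by
  classical
  induction T using Finset.induction_on with
  | empty => exact logFun_zero
  | insert a T ha ih =>
    simp only [Finset.sum_insert ha]
    exact (h a (by simp)).add (ih fun i hi => h i (by simp [hi]))

theorem logFun_prod_zpow (m : Fin n → ℤ) : LogFun S (-m) (fun z => ∏ i ∈ S, z i ^ m i) := by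
  refine ⟨1, analyticAt_const, ?_⟩
  filter_upwards [eventually_mem_offHyperplanes] with z hz
  rw [← Finset.prod_mul_distrib]
  refine Finset.prod_eq_one fun i hi => ?_
  rw [← zpow_add₀ (hz i hi)]
  simp

theorem analyticAt_prod_pow (T : Finset (Fin n)) (N : Fin n → ℕ) (z : Fin n → ℂ) :
    AnalyticAt ℂ (fun z : Fin n → ℂ => ∏ i ∈ T, z i ^ N i) z :=
  Finset.analyticAt_fun_prod T fun i _ => (analyticAt_coord i z).pow (N i)

theorem LogFun.mono (h : LogFun S m b) (hm : ∀ i ∈ S, m i ≤ m' i) : LogFun S m' b := by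
  obtain ⟨c, hc, h⟩ := h
  refine ⟨_, (analyticAt_prod_pow S (fun i => (m' i - m i).toNat) 0).mul hc, ?_⟩
  filter_upwards [h, eventually_mem_offHyperplanes] with z h hz
  rw [Pi.mul_apply, ← h, ← mul_assoc, ← Finset.prod_mul_distrib]
  congr 1
  refine Finset.prod_congr rfl fun i hi => ?_
  rw [← zpow_natCast, ← zpow_add₀ (hz i hi), Int.toNat_of_nonneg (by linarith [hm i hi])]
  congr 1
  ring

/-- Euler's relation: a monomial is an eigenvector of the logarithmic fields, which is why these do
not increase pole orders. -/
theorem hasFDerivAt_prod_zpow (m : Fin n → ℤ) (T : Finset (Fin n)) (hT : T ⊆ S)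
    {z : Fin n → ℂ} (hz : z ∈ offHyperplanes S) (i : Fin n) :
    ∃ L : (Fin n → ℂ) →L[ℂ] ℂ, HasFDerivAt (fun w : Fin n → ℂ => ∏ j ∈ T, w j ^ m j) L z ∧
      L (logFrame S z i) = (if i ∈ T then (m i : ℂ) else 0) * ∏ j ∈ T, z j ^ m j := by
  induction T using Finset.induction_on with
  | empty => exact ⟨0, by simpa using hasFDerivAt_const (1 : ℂ) z, by simp⟩
  | insert a T ha ih =>
    obtain ⟨L, hL, hL'⟩ := ih fun j hj => hT (by simp [hj])
    have haS : a ∈ S := hT (by simp)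
    have h1 : HasFDerivAt (fun w : Fin n → ℂ => w a ^ m a)
        (((m a : ℂ) * z a ^ (m a - 1)) •
          ContinuousLinearMap.proj (R := ℂ) (φ := fun _ : Fin n => ℂ) a) z :=
      HasDerivAt.comp_hasFDerivAt (f := fun w : Fin n → ℂ => w a) z
        (hasDerivAt_zpow (m a) (z a) (Or.inl (hz a haS))) (hasFDerivAt_apply a z)
    simp only [Finset.prod_insert ha]
    refine ⟨_, h1.fun_mul hL, ?_⟩
    have hza : z a ^ m a = z a ^ (m a - 1) * z a := by
      rw [← zpow_add_one₀ (hz a haS)]; simp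
    simp only [add_apply, smul_apply, hL',
      ContinuousLinearMap.proj_apply, smul_eq_mul, Finset.mem_insert]
    by_cases hia : i = a
    · subst hia
      simp [ha, logFrame, haS, hza]
      ring
    · have : logFrame S z i a = 0 := by simp [logFrame, Ne.symm hia]
      simp [this, hia]
      split_ifs <;> ring

/-- Leibniz rule for `b = z^{-m} c`. The explicit right-hand side matters: for `i ∈ S` its value at
the origin is `-m_i c(0)`, which gives the exact pole order in `hasLogPole_of_eq`. -/
theorem eventually_fderiv_logFrame {c : (Fin n → ℂ) → ℂ} (hc : AnalyticAt ℂ c 0)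
    (h : ∀ᶠ z in nhdsOff S, (∏ i ∈ S, z i ^ m i) * b z = c z) (i : Fin n) :
    ∀ᶠ z in nhdsOff S, (∏ j ∈ S, z j ^ m j) * fderiv ℂ b z (logFrame S z i) =
      fderiv ℂ c z (logFrame S z i) - (if i ∈ S then (m i : ℂ) else 0) * c z := by
  filter_upwards [eventually_nhdsOff_nhds h, eventually_mem_offHyperplanes,
    eventually_nhdsOff_of_nhds hc.eventually_analyticAt] with z h hz hcz
  obtain ⟨L, hL, hL'⟩ := hasFDerivAt_prod_zpow (-m) S subset_rfl hz i
  have hbc : b =ᶠ[𝓝 z] fun w => (∏ j ∈ S, w j ^ (-m) j) * c w := by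
    filter_upwards [h, (isOpen_offHyperplanes S).mem_nhds hz] with w hw hwS
    rw [← hw, ← mul_assoc, ← Finset.prod_mul_distrib, Finset.prod_eq_one, one_mul]
    intro j hj
    rw [← zpow_add₀ (hwS j hj)]
    simp
  rw [hbc.fderiv_eq, (hL.fun_mul hcz.differentiableAt.hasFDerivAt).fderiv]
  have hone : (∏ j ∈ S, z j ^ m j) * ∏ j ∈ S, z j ^ (-m) j = 1 := by
    rw [← Finset.prod_mul_distrib, Finset.prod_eq_one]
    intro j hj
    rw [← zpow_add₀ (hz j hj)]
    simp
  simp only [add_apply, smul_apply, smul_eq_mul, hL']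
  have hneg : (if i ∈ S then (((-m) i : ℤ) : ℂ) else 0) = -(if i ∈ S then (m i : ℂ) else 0) := by
    split_ifs <;> simp
  rw [hneg]
  linear_combination (fderiv ℂ c z (logFrame S z i) - (if i ∈ S then (m i : ℂ) else 0) * c z) * hone

theorem analyticAt_fderiv_logFrame {c : (Fin n → ℂ) → ℂ} {z : Fin n → ℂ}
    (hc : AnalyticAt ℂ c z) (i : Fin n) (t : ℂ) :
    AnalyticAt ℂ (fun z => fderiv ℂ c z (logFrame S z i) - t * c z) z :=
  (analyticAt_clm_apply hc.fderiv (analyticAt_logFrame i z)).sub (analyticAt_const.mul hc)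

theorem LogFun.fderiv_logFrame (h : LogFun S m b) (i : Fin n) :
    LogFun S m (fun z => fderiv ℂ b z (logFrame S z i)) := by
  obtain ⟨c, hc, h⟩ := h
  exact ⟨_, analyticAt_fderiv_logFrame hc i _, eventually_fderiv_logFrame hc h i⟩

theorem hasFDerivAt_logFrame (i : Fin n) (z : Fin n → ℂ) :
    HasFDerivAt (fun z => logFrame S z i) ((ContinuousLinearMap.single ℂ (fun _ : Fin n => ℂ) i).comp
      (if i ∈ S then ContinuousLinearMap.proj (R := ℂ) (φ := fun _ : Fin n => ℂ) i else 0)) z := by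
  refine (ContinuousLinearMap.single ℂ (fun _ : Fin n => ℂ) i).hasFDerivAt.comp z
    (f := fun z : Fin n → ℂ => if i ∈ S then z i else 1) ?_
  by_cases hi : i ∈ S
  · simp only [hi, if_true]; exact hasFDerivAt_apply i z
  · simp only [hi, if_false]; exact hasFDerivAt_const (1 : ℂ) z

/-- This removes the bracket terms from the invariant formula for the exterior derivative. -/
theorem lieBracket_logFrame (i j : Fin n) (z : Fin n → ℂ) :
    VectorField.lieBracket ℂ (fun z => logFrame S z i) (fun z => logFrame S z j) z = 0 := by
  rw [VectorField.lieBracket, (hasFDerivAt_logFrame i z).fderiv, (hasFDerivAt_logFrame j z).fderiv]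
  by_cases hij : i = j
  · subst hij; simp
  · have h1 : logFrame S z i j = 0 := by simp [logFrame, Ne.symm hij]
    have h2 : logFrame S z j i = 0 := by simp [logFrame, hij]
    by_cases hi : i ∈ S <;> by_cases hj : j ∈ S <;> simp [hi, hj, h1, h2]

end LogFun


/-! ### Operations on logarithmic forms -/

section LogForms

variable {n : ℕ} {S : Finset (Fin n)} {m m' : Fin n → ℤ} {k : ℕ}

theorem mem_logForms_iff {γ : HolForms S k} {η : (Fin n → ℂ) → Form n k}
    (h : (η : Germ (nhdsOff S) (Form n k)) = γ.1) :
    γ ∈ logForms S m k ↔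
      ∀ J : Fin k → Fin n, LogFun S m (fun z => η z (fun a => logFrame S z (J a))) := by
  constructor
  · rintro ⟨θ, hθ, hθ'⟩ J
    refine LogFun.congr (hθ' J) ?_
    filter_upwards [Germ.coe_eq.1 (h.trans hθ.symm)] with z hz
    rw [hz]
  · exact fun H => ⟨η, h, H⟩

theorem logForms_mono (h : ∀ i ∈ S, m i ≤ m' i) : logForms S m k ≤ logForms S m' k := by
  rintro γ ⟨η, hη, H⟩
  exact ⟨η, hη, fun J => LogFun.mono (H J) h⟩

variable {F : (Fin n → ℂ) → ℂ} (hF : ∀ᶠ z in nhdsOff S, AnalyticAt ℂ F z)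

theorem twistedD_apply (u v : ℂ) (γ : HolForms S k) :
    twistedD S F hF u v k γ = u • twistedD S F hF 1 0 k γ + v • twistedD S F hF 0 1 k γ := by
  obtain ⟨_, η, rfl, hη⟩ := γ
  refine Subtype.ext (Germ.coe_eq.2 (Eventually.of_forall fun z => ?_))
  change u • extDeriv η z + v • wedge (fderiv ℂ F z) (η z) =
    u • ((1 : ℂ) • extDeriv η z + (0 : ℂ) • wedge (fderiv ℂ F z) (η z)) +
      v • ((0 : ℂ) • extDeriv η z + (1 : ℂ) • wedge (fderiv ℂ F z) (η z))
  simp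

theorem twistedD_one_zero_coe {γ : HolForms S k} {η : (Fin n → ℂ) → Form n k}
    (h : (η : Germ (nhdsOff S) (Form n k)) = γ.1) :
    (↑(extDeriv η) : Germ (nhdsOff S) (Form n (k + 1))) = (twistedD S F hF 1 0 k γ).1 := by
  change _ = (1 : ℂ) • dGerm S k γ.1 + (0 : ℂ) • dfGerm S F k γ.1
  rw [← h]
  refine Germ.coe_eq.2 (Eventually.of_forall fun z => ?_)
  change _ = (1 : ℂ) • extDeriv η z + (0 : ℂ) • wedge (fderiv ℂ F z) (η z)
  simp

theorem twistedD_zero_one_coe {γ : HolForms S k} {η : (Fin n → ℂ) → Form n k}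
    (h : (η : Germ (nhdsOff S) (Form n k)) = γ.1) :
    (↑(fun z => wedge (fderiv ℂ F z) (η z)) : Germ (nhdsOff S) (Form n (k + 1))) =
      (twistedD S F hF 0 1 k γ).1 := by
  change _ = (0 : ℂ) • dGerm S k γ.1 + (1 : ℂ) • dfGerm S F k γ.1
  rw [← h]
  refine Germ.coe_eq.2 (Eventually.of_forall fun z => ?_)
  change _ = (0 : ℂ) • extDeriv η z + (1 : ℂ) • wedge (fderiv ℂ F z) (η z)
  simp

theorem exists_rep (γ : HolForms S k) : ∃ η : (Fin n → ℂ) → Form n k,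
    (η : Germ (nhdsOff S) (Form n k)) = γ.1 ∧ ∀ᶠ z in nhdsOff S, AnalyticAt ℂ η z := γ.2

/-- On commuting logarithmic fields, `dη` is an alternating sum of logarithmic derivatives of the
coefficients of `η`, and these derivatives preserve `LogFun S m`. -/
theorem extDeriv_mem_logForms {γ : HolForms S k} (h : γ ∈ logForms S m k) :
    twistedD S F hF 1 0 k γ ∈ logForms S m (k + 1) := by
  obtain ⟨η, hη, han⟩ := exists_rep γ
  rw [mem_logForms_iff hη] at h
  rw [mem_logForms_iff (twistedD_one_zero_coe hF hη)]
  intro J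
  have H : LogFun S m (fun z => ∑ i : Fin (k + 1), (-1) ^ i.val *
      fderiv ℂ (fun x => η x (fun a => logFrame S x (J (i.succAbove a)))) z
        (logFrame S z (J i))) :=
    LogFun.sum fun i _ => ((h (fun a => J (i.succAbove a))).fderiv_logFrame (J i)).const_mul _
  refine H.congr ?_
  filter_upwards [han] with z hz
  have h1 := extDeriv_apply_vectorField_of_pairwise_commute
    (V := fun a x => logFrame S x (J a)) hz.differentiableAt
    (fun a => (analyticAt_logFrame (S := S) (J a) z).differentiableAt)
    (fun i j _ => lieBracket_logFrame (J i) (J j) z)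
  rw [h1]
  refine Finset.sum_congr rfl fun i _ => ?_
  simp only [Int.reduceNeg, zsmul_eq_mul]
  push_cast
  rfl

theorem dF_mem_logForms {e : Fin n → ℤ} (hFe : LogFun S e F) {γ : HolForms S k}
    (h : γ ∈ logForms S m k) :
    twistedD S F hF 0 1 k γ ∈ logForms S (m + e) (k + 1) := by
  obtain ⟨η, hη, han⟩ := exists_rep γ
  rw [mem_logForms_iff hη] at h
  rw [mem_logForms_iff (twistedD_zero_one_coe hF hη)]
  intro J
  have H : LogFun S (m + e) (fun z => ∑ i : Fin (k + 1), (-1) ^ i.val *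
      (η z (fun a => logFrame S z (J (i.succAbove a))) * fderiv ℂ F z (logFrame S z (J i)))) :=
    LogFun.sum fun i _ => ((h (fun a => J (i.succAbove a))).mul
      (hFe.fderiv_logFrame (J i))).const_mul _
  refine H.congr (Eventually.of_forall fun z => ?_)
  simp only [wedge_apply]
  refine Finset.sum_congr rfl fun i _ => ?_
  rw [mul_comm (η z _)]
  simp only [Int.reduceNeg, zsmul_eq_mul]
  push_cast
  rfl

/-- The function `F` has a pole of order `e`, and its derivative along one of the logarithmic
vector fields has a pole of order exactly `e`. -/
def HasLogPole (S : Finset (Fin n)) (e : Fin n → ℤ) (F : (Fin n → ℂ) → ℂ) : Prop :=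
  LogFun S e F ∧ ∃ i : Fin n, LogFun S (-e) (fun z => (fderiv ℂ F z (logFrame S z i))⁻¹) ∧
    ∀ᶠ z in nhdsOff S, fderiv ℂ F z (logFrame S z i) ≠ 0

variable {e : Fin n → ℤ}

/-- The contraction of a form by the `i`-th logarithmic vector field, divided by the derivative of
`F` along this vector field. -/
def contraction (S : Finset (Fin n)) (F : (Fin n → ℂ) → ℂ) (i : Fin n)
    (η : (Fin n → ℂ) → Form n (k + 1)) (z : Fin n → ℂ) : Form n k :=
  (fderiv ℂ F z (logFrame S z i))⁻¹ • (η z).curryLeft (logFrame S z i)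

theorem analyticAt_contraction {i : Fin n} {η : (Fin n → ℂ) → Form n (k + 1)} {z : Fin n → ℂ}
    (hFz : AnalyticAt ℂ F z) (h0 : fderiv ℂ F z (logFrame S z i) ≠ 0)
    (hη : AnalyticAt ℂ η z) : AnalyticAt ℂ (contraction S F i η) z :=
  ((analyticAt_clm_apply hFz.fderiv (analyticAt_logFrame i z)).inv h0).smul
    (analyticAt_curryLeft hη (analyticAt_logFrame i z))

theorem logFun_contraction {i : Fin n}
    (hi : LogFun S (-e) (fun z => (fderiv ℂ F z (logFrame S z i))⁻¹))
    {η : (Fin n → ℂ) → Form n (k + 1)}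
    (h : ∀ J : Fin (k + 1) → Fin n, LogFun S (m + e) (fun z => η z (fun a => logFrame S z (J a))))
    (J : Fin k → Fin n) :
    LogFun S m (fun z => contraction S F i η z (fun a => logFrame S z (J a))) := by
  have H := hi.mul (h (Matrix.vecCons i J))
  rw [show -e + (m + e) = m by abel] at H
  refine H.congr (Eventually.of_forall fun z => ?_)
  change (fderiv ℂ F z (logFrame S z i))⁻¹ *
    η z (Matrix.vecCons (logFrame S z i) fun a => logFrame S z (J a)) = _
  congr 2
  ext a : 1
  refine Fin.cases ?_ (fun a => ?_) a <;> simp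

theorem contraction_wedge_add {i : Fin n} {η : (Fin n → ℂ) → Form n (k + 1)} {z : Fin n → ℂ}
    (h0 : fderiv ℂ F z (logFrame S z i) ≠ 0) :
    contraction S F i (fun z => wedge (fderiv ℂ F z) (η z)) z +
      wedge (fderiv ℂ F z) (contraction S F i η z) = η z := by
  have h := curryLeft_wedge_add_wedge_curryLeft (fderiv ℂ F z) (η z) (logFrame S z i)
  have hw : ∀ (c : ℂ) (w : Form n k),
      wedge (fderiv ℂ F z) (c • w) = c • wedge (fderiv ℂ F z) w := fun c w => by
    simp only [wedge_eq, map_smul]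
  unfold contraction
  rw [hw]
  ext v
  have hv : (wedge (fderiv ℂ F z) (η z)).curryLeft (logFrame S z i) v +
      wedge (fderiv ℂ F z) ((η z).curryLeft (logFrame S z i)) v =
        fderiv ℂ F z (logFrame S z i) * η z v := congrArg (fun w => w v) h
  change (fderiv ℂ F z (logFrame S z i))⁻¹ *
      (wedge (fderiv ℂ F z) (η z)).curryLeft (logFrame S z i) v +
    (fderiv ℂ F z (logFrame S z i))⁻¹ *
      wedge (fderiv ℂ F z) ((η z).curryLeft (logFrame S z i)) v = η z v
  rw [← mul_add, hv, inv_mul_cancel_left₀ h0]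

theorem contraction_wedge_zero {i : Fin n} {η : (Fin n → ℂ) → Form n 0} {z : Fin n → ℂ}
    (h0 : fderiv ℂ F z (logFrame S z i) ≠ 0) :
    contraction S F i (fun z => wedge (fderiv ℂ F z) (η z)) z = η z := by
  rw [contraction, curryLeft_wedge_zero, smul_smul, inv_mul_cancel₀ h0, one_smul]

/-- Here `ξ` and `ζ` are the normalised contractions of `γ` and of `dF ∧ γ`. They do not depend on
`m`, so the two pole estimates can later be used with different values of `m`. -/
theorem HasLogPole.exists_homotopy (hFe : HasLogPole S e F) (γ : HolForms S (k + 1)) :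
    ∃ (ξ : HolForms S k) (ζ : HolForms S (k + 1)), γ = twistedD S F hF 0 1 k ξ + ζ ∧
      (∀ m, γ ∈ logForms S (m + e) (k + 1) → ξ ∈ logForms S m k) ∧
      ∀ m, twistedD S F hF 0 1 (k + 1) γ ∈ logForms S (m + e) (k + 2) →
        ζ ∈ logForms S m (k + 1) := by
  obtain ⟨-, i, hi, hi0⟩ := hFe
  obtain ⟨η, hη, han⟩ := exists_rep γ
  let θ : (Fin n → ℂ) → Form n (k + 2) := fun z => wedge (fderiv ℂ F z) (η z)
  have hθ : ∀ᶠ z in nhdsOff S, AnalyticAt ℂ θ z :=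
    (hF.and han).mono fun z h => analyticAt_wedge h.1 h.2
  refine ⟨⟨↑(contraction S F i η), contraction S F i η, rfl, ?_⟩,
    ⟨↑(contraction S F i θ), contraction S F i θ, rfl, ?_⟩, Subtype.ext ?_,
    fun m h => ?_, fun m h => ?_⟩
  · filter_upwards [han, hF, hi0] with z h1 h2 h3 using analyticAt_contraction h2 h3 h1
  · filter_upwards [hθ, hF, hi0] with z h1 h2 h3 using analyticAt_contraction h2 h3 h1
  · rw [Submodule.coe_add, ← hη, ← twistedD_zero_one_coe hF rfl]
    refine Germ.coe_eq.2 ?_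
    filter_upwards [hi0] with z h0
    exact (contraction_wedge_add h0).symm.trans (add_comm _ _)
  · rw [mem_logForms_iff hη] at h
    exact (mem_logForms_iff rfl).2 (logFun_contraction hi h)
  · rw [mem_logForms_iff (twistedD_zero_one_coe hF hη)] at h
    exact (mem_logForms_iff rfl).2 (logFun_contraction hi h)

/-- In degree zero the contraction term of the homotopy is absent: a function is recovered from `dF
∧ γ` alone. -/
theorem HasLogPole.mem_logForms_of_dF (hFe : HasLogPole S e F) {γ : HolForms S 0}
    (h : twistedD S F hF 0 1 0 γ ∈ logForms S (m + e) 1) : γ ∈ logForms S m 0 := by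
  obtain ⟨-, i, hi, hi0⟩ := hFe
  obtain ⟨η, hη, han⟩ := exists_rep γ
  rw [mem_logForms_iff (twistedD_zero_one_coe hF hη)] at h
  refine (mem_logForms_iff
      (η := contraction S F i (fun z => wedge (fderiv ℂ F z) (η z))) ?_).2
      (logFun_contraction hi h)
  rw [← hη]
  refine Germ.coe_eq.2 ?_
  filter_upwards [hi0] with z h0
  exact contraction_wedge_zero h0

end LogForms


/-! ### The filtered quasi-isomorphisms on stalks -/

section StalkTheorems

variable {n : ℕ} {S : Finset (Fin n)} {k : ℕ} {F : (Fin n → ℂ) → ℂ}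

/-- With `X = z_i ∂/∂z_i`, the product `z^e X F` is `X w - e_i w`; its value at the origin is `-e_i
w(0) ≠ 0`, since `X` vanishes there. -/
theorem hasLogPole_of_eq {e : Fin n → ℤ} {w : (Fin n → ℂ) → ℂ} (hw : AnalyticAt ℂ w 0)
    (hw0 : w 0 ≠ 0) {i : Fin n} (hi : i ∈ S) (hei : e i ≠ 0)
    (h : ∀ᶠ z in nhdsOff S, (∏ i ∈ S, z i ^ e i) * F z = w z) : HasLogPole S e F := by
  have h1 := eventually_fderiv_logFrame hw h i
  set c := fun z => fderiv ℂ w z (logFrame S z i) - (if i ∈ S then (e i : ℂ) else 0) * w z with hcdef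
  have hc : AnalyticAt ℂ c 0 := analyticAt_fderiv_logFrame hw i _
  have hc0 : c 0 ≠ 0 := by
    have : logFrame S 0 i = 0 := by simp [logFrame, hi]
    simp [hcdef, this, hi, hei, hw0]
  refine ⟨⟨w, hw, h⟩, i, ⟨fun z => (c z)⁻¹, hc.inv hc0, ?_⟩, ?_⟩
  · filter_upwards [h1] with z h1
    rw [← show _ = c z from h1, mul_inv, ← Finset.prod_inv_distrib]
    simp
  · filter_upwards [h1, eventually_nhdsOff_of_nhds (hc.continuousAt.eventually_ne hc0)]
      with z h1 h2 h3
    rw [h3, mul_zero] at h1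
    exact h2 h1.symm

variable {e : Fin n → ℕ}

theorem logP_mono {a b : ℝ} (h : a ≤ b) : logP S e a k ≤ logP S e b k :=
  logForms_mono fun i _ => Int.floor_mono (by gcongr)

/-- The multiplicities are integers, so increasing `a` by one shifts the integral parts by exactly
`P`, the amount by which `df ∧` and the homotopy change the poles. -/
theorem logP_add_one (a : ℝ) :
    logP S e (a + 1) k = logForms S ((fun i => ⌊a * (e i : ℝ)⌋) + fun i => (e i : ℤ)) k := by
  unfold logP
  congr 1
  ext i
  simp only [Pi.add_apply]
  rw [add_mul, one_mul, Int.floor_add_natCast]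

variable (hF : ∀ᶠ z in nhdsOff S, AnalyticAt ℂ F z) (u : ℂ)

theorem d_mem_logP {a : ℝ} {γ : HolForms S k} (h : γ ∈ logP S e a k) :
    twistedD S F hF 1 0 k γ ∈ logP S e a (k + 1) := extDeriv_mem_logForms hF h

theorem twistedD_one_apply (γ : HolForms S k) :
    twistedD S F hF u 1 k γ = u • twistedD S F hF 1 0 k γ + twistedD S F hF 0 1 k γ := by
  rw [twistedD_apply, one_smul]

theorem twistedD_mem_iff {a : ℝ} {γ : HolForms S k} (h : γ ∈ logP S e a k) :
    twistedD S F hF u 1 k γ ∈ logP S e a (k + 1) ↔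
      twistedD S F hF 0 1 k γ ∈ logP S e a (k + 1) := by
  have h1 := Submodule.smul_mem _ u (d_mem_logP hF h)
  have h2 := twistedD_one_apply hF u γ
  constructor
  · intro h'
    have h3 : twistedD S F hF 0 1 k γ =
        twistedD S F hF u 1 k γ + (-1 : ℂ) • u • twistedD S F hF 1 0 k γ := by
      rw [h2]; module
    rw [h3]
    exact Submodule.add_mem _ h' (Submodule.smul_mem _ _ h1)
  · intro h'
    rw [h2]
    exact Submodule.add_mem _ h1 h'

/-- As `d` preserves the pole order, the kernel condition on `df ∧` may be tested on `u d + df ∧`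
for any `u`. -/
theorem mem_kontsevich_iff {μ : ℝ} {γ : HolForms S k} :
    γ ∈ kontsevich S e F hF μ k ↔
      γ ∈ logP S e μ k ∧ twistedD S F hF u 1 k γ ∈ logP S e μ (k + 1) :=
  and_congr_right fun h => (twistedD_mem_iff hF u h).symm

theorem twistedD_mem_logP (hFe : LogFun S (fun i => (e i : ℤ)) F) {a : ℝ} {γ : HolForms S k}
    (h : γ ∈ logP S e a k) : twistedD S F hF u 1 k γ ∈ logP S e (a + 1) (k + 1) := by
  rw [twistedD_one_apply]
  refine Submodule.add_mem _
    (Submodule.smul_mem _ _ (logP_mono (by linarith) (d_mem_logP hF h))) ?_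
  rw [logP_add_one]
  exact dF_mem_logForms hF hFe h

theorem mem_logP_of_twistedD_mem (hFe : HasLogPole S (fun i => (e i : ℤ)) F) {a b : ℝ}
    (hab : a ≤ b) {γ : HolForms S 0} (h : γ ∈ logP S e (a + 1) 0)
    (h' : twistedD S F hF u 1 0 γ ∈ logP S e (b + 1) 1) : γ ∈ logP S e b 0 := by
  have h1 := (twistedD_mem_iff hF u (logP_mono (by linarith) h)).1 h'
  rw [logP_add_one] at h1
  exact hFe.mem_logForms_of_dF hF h1

theorem exists_eq_twistedD_add (hFe : HasLogPole S (fun i => (e i : ℤ)) F) {a b : ℝ}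
    (hab : a ≤ b) {γ : HolForms S (k + 1)} (h : γ ∈ logP S e (a + 1) (k + 1))
    (h' : twistedD S F hF u 1 (k + 1) γ ∈ logP S e (b + 1) (k + 2)) :
    ∃ ξ ∈ logP S e a k, ∃ ζ ∈ logP S e b (k + 1), γ = twistedD S F hF u 1 k ξ + ζ := by
  obtain ⟨ξ, ζ, h0, h1, h2⟩ := hFe.exists_homotopy hF γ
  have h3 := (twistedD_mem_iff hF u (logP_mono (by linarith) h)).1 h'
  rw [logP_add_one] at h3 h
  have hξ : ξ ∈ logP S e a k := h1 _ h
  -- Replacing `df ∧ ξ` by `(u d + df ∧) ξ` costs `u dξ`, which has no more poles than `ξ` and is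
  -- absorbed in the remainder because `a ≤ b`.
  refine ⟨ξ, hξ, ζ + (-u) • twistedD S F hF 1 0 k ξ, Submodule.add_mem _ (h2 _ h3)
    (Submodule.smul_mem _ _ (logP_mono hab (d_mem_logP hF hξ))), ?_⟩
  rw [twistedD_one_apply, h0]
  module

end StalkTheorems

/-! ### Formal consequences -/

section PoleReduction

variable {M : ℕ → Type} [∀ k, AddCommGroup (M k)] [∀ k, Module ℂ (M k)]
  (δ : ∀ k, M k →ₗ[ℂ] M (k + 1))

/-- An increasing family `L a`, `a ∈ ℝ`, of graded subspaces of `(M, δ)`, such that `δ` increases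
`a` by `1`, and such that every element of `L (a + 1)` with differential in `L (b + 1)`, `a ≤ b`,
belongs to `L b` modulo `δ (L a)`. -/
structure HasPoleReduction (L : ℝ → ∀ k, Submodule ℂ (M k)) : Prop where
  comp_eq_zero : ∀ k (x : M k), δ (k + 1) (δ k x) = 0
  mono : ∀ {a b : ℝ}, a ≤ b → ∀ {k} {x : M k}, x ∈ L a k → x ∈ L b k
  map_mem : ∀ {a : ℝ} {k} {x : M k}, x ∈ L a k → δ k x ∈ L (a + 1) (k + 1)
  reduce_zero : ∀ {a b : ℝ}, a ≤ b → ∀ {x : M 0}, x ∈ L (a + 1) 0 →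
    δ 0 x ∈ L (b + 1) 1 → x ∈ L b 0
  reduce_succ : ∀ {a b : ℝ}, a ≤ b → ∀ {k} {x : M (k + 1)}, x ∈ L (a + 1) (k + 1) →
    δ (k + 1) x ∈ L (b + 1) (k + 2) → ∃ ξ ∈ L a k, ∃ ζ ∈ L b (k + 1), x = δ k ξ + ζ

variable {δ} {L : ℝ → ∀ k, Submodule ℂ (M k)}

namespace HasPoleReduction

theorem reduce_zero_nat (h : HasPoleReduction δ L) {a : ℝ} (N : ℕ) {x : M 0}
    (hx : x ∈ L (a + N) 0) (hx' : δ 0 x ∈ L (a + 1) 1) : x ∈ L a 0 := by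
  induction N with
  | zero => simpa using hx
  | succ N ih =>
    push_cast at hx
    rw [← add_assoc] at hx
    exact ih (h.reduce_zero le_rfl hx (h.mono (by linarith [N.cast_nonneg (α := ℝ)]) hx'))

/-- The poles are lowered by one unit `N` times; the primitive of the first reduction has the
largest poles, whence `a + N - 1`. -/
theorem reduce_succ_nat (h : HasPoleReduction δ L) {a : ℝ} (N : ℕ) {k : ℕ} {x : M (k + 1)}
    (hx : x ∈ L (a + N) (k + 1)) (hx' : δ (k + 1) x ∈ L (a + 1) (k + 2)) :
    ∃ ξ ∈ L (a + N - 1) k, x - δ k ξ ∈ L a (k + 1) := by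
  induction N generalizing x with
  | zero => exact ⟨0, Submodule.zero_mem _, by simpa using hx⟩
  | succ N ih =>
    push_cast at hx
    rw [← add_assoc] at hx
    obtain ⟨ξ, hξ, ζ, hζ, rfl⟩ := h.reduce_succ le_rfl hx
      (h.mono (by linarith [N.cast_nonneg (α := ℝ)]) hx')
    -- The remainder `ζ` has the same differential as the original form, so the reduction can be
    -- repeated.
    rw [map_add, h.comp_eq_zero, zero_add] at hx'
    obtain ⟨ξ', hξ', hζ'⟩ := ih hζ hx'
    refine ⟨ξ + ξ', Submodule.add_mem _ (h.mono (by push_cast; linarith) hξ)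
      (h.mono (by push_cast; linarith) hξ'), ?_⟩
    rwa [map_add, add_sub_add_left_eq_sub]

end HasPoleReduction

end PoleReduction


/-! ### Comparison of the filtrations by pole reduction -/

section PoleFiltrations

variable {M : ℕ → Type} [∀ k, AddCommGroup (M k)] [∀ k, Module ℂ (M k)]
  {δ : ∀ k, M k →ₗ[ℂ] M (k + 1)}

/-- The stupid filtration of a graded subspace. -/
def stupidFiltration (K : ∀ k, Submodule ℂ (M k)) (p : ℤ) (k : ℕ) : Submodule ℂ (M k) :=
  if p ≤ (k : ℤ) then K k else ⊥

/-- The filtration by shifted truncations of `L (k + μ)`. -/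
def poleFiltration (L : ℝ → ∀ k, Submodule ℂ (M k)) (μ : ℝ) (p : ℤ) (k : ℕ) :
    Submodule ℂ (M k) :=
  if p ≤ 0 then L ((k : ℝ) - (-μ)) k
  else if p ≤ (k : ℤ) then L ((k : ℝ) - (p : ℝ) + μ) k else ⊥

/-- The graded subspace `L (k - lam)` in the degrees `k ≥ lam`. -/
def positivePart (L : ℝ → ∀ k, Submodule ℂ (M k)) (lam : ℝ) (k : ℕ) : Submodule ℂ (M k) :=
  open Classical in if 0 ≤ (k : ℝ) - lam then L ((k : ℝ) - lam) k else ⊥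

/-- The filtration `positivePart L (-α + p)`. -/
def yuFiltration (L : ℝ → ∀ k, Submodule ℂ (M k)) (α : ℝ) (p : ℤ) (k : ℕ) : Submodule ℂ (M k) :=
  positivePart L (-α + (p : ℝ)) k

/-- The filtration equal to `positivePart L 0` for `p ≤ 0` and to `positivePart L (-α + p)` for
`p ≥ 1`. -/
def truncatedYuFiltration (L : ℝ → ∀ k, Submodule ℂ (M k)) (α : ℝ) (p : ℤ) (k : ℕ) :
    Submodule ℂ (M k) :=
  if p ≤ 0 then positivePart L 0 k else positivePart L (-α + (p : ℝ)) k

theorem stupidFiltration_eq (K : ∀ k, Submodule ℂ (M k)) (p : ℤ) (k : ℕ) :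
    stupidFiltration K p k = if p.toNat ≤ k then K k else ⊥ := by
  simp only [stupidFiltration, Int.toNat_le]

/-- Using `p.toNat` merges the cases `p ≤ 0` and `p > 0` into a single formula. -/
theorem poleFiltration_eq (L : ℝ → ∀ k, Submodule ℂ (M k)) (μ : ℝ) (p : ℤ) (k : ℕ) :
    poleFiltration L μ p k = if p.toNat ≤ k then L ((k : ℝ) - p.toNat + μ) k else ⊥ := by
  unfold poleFiltration
  rcases le_or_gt p 0 with hp | hp
  · simp [hp, Int.toNat_of_nonpos hp]
  · obtain ⟨q, rfl⟩ := Int.eq_ofNat_of_zero_le hp.le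
    have : ¬ (q : ℤ) ≤ 0 := not_le.2 hp
    simp only [this, if_false, Int.toNat_natCast, Nat.cast_le, Int.cast_natCast]

/-- For integers `k` and `p` and `0 ≤ α < 1`, the sign condition `k ≥ p - α` amounts to `k ≥ p`. -/
theorem yuFiltration_eq (L : ℝ → ∀ k, Submodule ℂ (M k)) {α : ℝ} (h0 : 0 ≤ α) (h1 : α < 1) (p : ℤ)
    (k : ℕ) : yuFiltration L α p k = if p ≤ (k : ℤ) then L ((k : ℝ) - p + α) k else ⊥ := by
  unfold yuFiltration positivePart
  have hiff : 0 ≤ (k : ℝ) - (-α + p) ↔ p ≤ (k : ℤ) := by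
    constructor
    · intro h
      have : (p : ℝ) < ((k + 1 : ℤ) : ℝ) := by push_cast; linarith
      have := Int.cast_lt.1 this
      lia
    · intro h
      have : (p : ℝ) ≤ ((k : ℤ) : ℝ) := Int.cast_le.2 h
      push_cast at this
      linarith
  simp only [hiff]
  rw [show (k : ℝ) - (-α + p) = (k : ℝ) - p + α by ring]

theorem truncatedYuFiltration_of_nonpos (L : ℝ → ∀ k, Submodule ℂ (M k)) (α : ℝ) {p : ℤ}
    (hp : p ≤ 0) (k : ℕ) : truncatedYuFiltration L α p k = L k k := by
  simp [truncatedYuFiltration, positivePart, hp]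

theorem truncatedYuFiltration_of_pos (L : ℝ → ∀ k, Submodule ℂ (M k)) (α : ℝ) {p : ℤ}
    (hp : 0 < p) (k : ℕ) : truncatedYuFiltration L α p k = yuFiltration L α p k := by
  simp [truncatedYuFiltration, yuFiltration, not_le.2 hp]

theorem poleFiltration_of_pos (L : ℝ → ∀ k, Submodule ℂ (M k)) {α : ℝ} (h0 : 0 ≤ α) (h1 : α < 1)
    {p : ℤ} (hp : 0 < p) (k : ℕ) : poleFiltration L α p k = yuFiltration L α p k := by
  simp [poleFiltration, yuFiltration_eq L h0 h1, not_le.2 hp]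

theorem quotientExact_refl (A : ∀ k, Submodule ℂ (M k)) : QuotientExact δ A A :=
  ⟨fun _ h _ => h, fun _ x hx _ => ⟨0, Submodule.zero_mem _, by simpa using hx⟩⟩

theorem isFilteredQuasiIso_refl (hδ : ∀ k (x : M k), δ (k + 1) (δ k x) = 0)
    {A : ℤ → ∀ k, Submodule ℂ (M k)} (hA : IsFiltration δ A) : IsFilteredQuasiIso δ hδ A A :=
  isFilteredQuasiIso_of_quotientExact δ hδ hA hA (fun _ _ => le_rfl) fun _ => quotientExact_refl _

theorem isFiltration_stupidFiltration {K : ∀ k, Submodule ℂ (M k)} (hK : IsSubcomplex δ K) :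
    IsFiltration δ (stupidFiltration K) where
  isSubcomplex p k x hx := by
    unfold stupidFiltration at hx ⊢
    split_ifs at hx with h
    · rw [if_pos (by push_cast; lia)]
      exact hK k x hx
    · rw [(Submodule.mem_bot ℂ).1 hx, map_zero]
      exact Submodule.zero_mem _
  antitone p q hpq k := by
    unfold stupidFiltration
    split_ifs
    · exact le_rfl
    · lia
    · exact bot_le
    · exact le_rfl

variable {L : ℝ → ∀ k, Submodule ℂ (M k)}

namespace HasPoleReduction

theorem le (h : HasPoleReduction δ L) {a b : ℝ} (hab : a ≤ b) (k : ℕ) : L a k ≤ L b k :=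
  fun _ hx => h.mono hab hx

theorem isFiltration_poleFiltration (h : HasPoleReduction δ L) (μ : ℝ) :
    IsFiltration δ (poleFiltration L μ) where
  isSubcomplex p k x hx := by
    rw [poleFiltration_eq] at hx ⊢
    split_ifs at hx with hk
    · rw [if_pos (by lia)]
      exact h.mono (by push_cast; linarith) (h.map_mem hx)
    · rw [(Submodule.mem_bot ℂ).1 hx, map_zero]
      exact Submodule.zero_mem _
  antitone p q hpq k := by
    rw [poleFiltration_eq, poleFiltration_eq]
    have hpq' : p.toNat ≤ q.toNat := Int.toNat_le_toNat hpq
    have : (p.toNat : ℝ) ≤ q.toNat := Nat.cast_le.2 hpq'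
    split_ifs
    · exact h.le (by linarith) k
    · lia
    · exact bot_le
    · exact le_rfl

theorem isFiltration_yuFiltration (h : HasPoleReduction δ L) {α : ℝ} (h0 : 0 ≤ α) (h1 : α < 1) :
    IsFiltration δ (yuFiltration L α) where
  isSubcomplex p k x hx := by
    rw [yuFiltration_eq L h0 h1] at hx ⊢
    split_ifs at hx with hk
    · rw [if_pos (by push_cast; lia)]
      exact h.mono (by push_cast; linarith) (h.map_mem hx)
    · rw [(Submodule.mem_bot ℂ).1 hx, map_zero]
      exact Submodule.zero_mem _
  antitone p q hpq k := by
    rw [yuFiltration_eq L h0 h1, yuFiltration_eq L h0 h1]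
    have : (p : ℝ) ≤ q := Int.cast_le.2 hpq
    split_ifs
    · exact h.le (by linarith) k
    · lia
    · exact bot_le
    · exact le_rfl

theorem isFiltration_truncatedYuFiltration (h : HasPoleReduction δ L) {α : ℝ} (h0 : 0 ≤ α)
    (h1 : α < 1) : IsFiltration δ (truncatedYuFiltration L α) where
  isSubcomplex p k x hx := by
    rcases le_or_gt p 0 with hp | hp
    · rw [truncatedYuFiltration_of_nonpos L α hp] at hx ⊢
      exact h.mono (by push_cast; linarith) (h.map_mem hx)
    · rw [truncatedYuFiltration_of_pos L α hp] at hx ⊢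
      exact (h.isFiltration_yuFiltration h0 h1).isSubcomplex p k x hx
  antitone p q hpq k := by
    rcases le_or_gt q 0 with hq | hq
    · rw [truncatedYuFiltration_of_nonpos L α hq, truncatedYuFiltration_of_nonpos L α (hpq.trans hq)]
    rcases le_or_gt p 0 with hp | hp
    · rw [truncatedYuFiltration_of_nonpos L α hp, truncatedYuFiltration_of_pos L α hq,
        yuFiltration_eq L h0 h1]
      have : (1 : ℝ) ≤ q := by exact_mod_cast hq
      split_ifs
      · exact h.le (by linarith) k
      · exact bot_le
    · rw [truncatedYuFiltration_of_pos L α hp, truncatedYuFiltration_of_pos L α hq]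
      exact (h.isFiltration_yuFiltration h0 h1).antitone p q hpq k

variable {μ : ℝ} {K : ∀ k, Submodule ℂ (M k)}

theorem isSubcomplex_of_mem_iff (h : HasPoleReduction δ L)
    (hK : ∀ k x, x ∈ K k ↔ x ∈ L μ k ∧ δ k x ∈ L μ (k + 1)) : IsSubcomplex δ K := by
  intro k x hx
  refine (hK _ _).2 ⟨((hK _ _).1 hx).2, ?_⟩
  rw [h.comp_eq_zero]
  exact Submodule.zero_mem _

theorem quotientExact_stupidFiltration_poleFiltration (h : HasPoleReduction δ L)
    (hK : ∀ k x, x ∈ K k ↔ x ∈ L μ k ∧ δ k x ∈ L μ (k + 1)) (p : ℤ) :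
    QuotientExact δ (stupidFiltration K p) (poleFiltration L μ p) := by
  constructor
  · intro x hx hx'
    rw [poleFiltration_eq] at hx
    rw [stupidFiltration_eq] at hx' ⊢
    split_ifs at hx with hp
    · rw [if_pos hp]
      rw [if_pos (by lia)] at hx'
      exact (hK _ _).2 ⟨h.mono (by simp) hx, ((hK _ _).1 hx').1⟩
    · rw [(Submodule.mem_bot ℂ).1 hx]
      exact Submodule.zero_mem _
  · intro k x hx hx'
    rw [poleFiltration_eq] at hx
    rw [stupidFiltration_eq] at hx'
    rw [stupidFiltration_eq, poleFiltration_eq]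
    split_ifs at hx with hp
    · rw [if_pos (by lia)] at hx'
      rw [if_pos hp]
      have hx'' := ((hK _ _).1 hx').1
      rcases hp.lt_or_eq with hp' | hp'
      · rw [if_pos (by lia)]
        -- With this number `N` of reductions, the bound `μ + N - 1` on the primitive is exactly the
        -- pole order allowed in degree `k`.
        have hN : ((k + 1 - p.toNat : ℕ) : ℝ) = (k : ℝ) + 1 - p.toNat := by
          rw [Nat.cast_sub hp]; push_cast; ring
        obtain ⟨ξ, hξ, hξ'⟩ := h.reduce_succ_nat (a := μ) (k + 1 - p.toNat)
          (h.mono (by rw [hN]; push_cast; linarith) hx) (h.mono (by linarith) hx'')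
        refine ⟨ξ, h.mono (by rw [hN]; linarith) hξ, (hK _ _).2 ⟨hξ', ?_⟩⟩
        rwa [map_sub, h.comp_eq_zero, sub_zero]
      -- In the lowest degree of the truncation there is nothing to reduce: the pole order is
      -- already `μ`.
      · refine ⟨0, Submodule.zero_mem _, ?_⟩
        rw [map_zero, sub_zero]
        exact (hK _ _).2 ⟨h.mono (by rw [hp']; simp) hx, hx''⟩
    · refine ⟨0, Submodule.zero_mem _, ?_⟩
      rw [(Submodule.mem_bot ℂ).1 hx, map_zero, sub_zero]
      exact Submodule.zero_mem _

theorem isFilteredQuasiIso_stupidFiltration_poleFiltration (h : HasPoleReduction δ L)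
    (hK : ∀ k x, x ∈ K k ↔ x ∈ L μ k ∧ δ k x ∈ L μ (k + 1)) :
    IsFilteredQuasiIso δ h.comp_eq_zero (stupidFiltration K) (poleFiltration L μ) := by
  refine isFilteredQuasiIso_of_quotientExact δ _
    (isFiltration_stupidFiltration (h.isSubcomplex_of_mem_iff hK))
    (h.isFiltration_poleFiltration μ) (fun p k x hx => ?_)
    (h.quotientExact_stupidFiltration_poleFiltration hK)
  rw [stupidFiltration_eq] at hx
  rw [poleFiltration_eq]
  split_ifs at hx ⊢ with hp
  · have : (p.toNat : ℝ) ≤ k := Nat.cast_le.2 hp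
    exact h.mono (by linarith) ((hK _ _).1 hx).1
  · exact hx

variable {α : ℝ}

theorem isFilteredQuasiIso_stupidFiltration_truncatedYuFiltration (h : HasPoleReduction δ L)
    (h0 : 0 ≤ α) (h1 : α < 1) (hK : ∀ k x, x ∈ K k ↔ x ∈ L α k ∧ δ k x ∈ L α (k + 1)) :
    IsFilteredQuasiIso δ h.comp_eq_zero (stupidFiltration K) (truncatedYuFiltration L α) := by
  have hpole := h.isFilteredQuasiIso_stupidFiltration_poleFiltration hK
  refine isFilteredQuasiIso_of_quotientExact δ _
    (isFiltration_stupidFiltration (h.isSubcomplex_of_mem_iff hK))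
    (h.isFiltration_truncatedYuFiltration h0 h1) (fun p k x hx => ?_) (fun p => ?_)
  · rcases le_or_gt p 0 with hp | hp
    · rw [truncatedYuFiltration_of_nonpos L α hp]
      rw [stupidFiltration, if_pos (by lia)] at hx
      obtain ⟨hx1, hx2⟩ := (hK _ _).1 hx
      cases k with
      | zero =>
        -- The inclusion is not evident for functions, where only `L 0` is allowed. Reduction even
        -- gives `L (α - 1)`, and `α < 1`.
        exact h.mono (by simp; linarith) (h.reduce_zero (a := α - 1) le_rfl (by simpa using hx1)
          (by simpa using hx2))
      | succ k => exact h.mono (by push_cast; linarith [k.cast_nonneg (α := ℝ)]) hx1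
    · rw [truncatedYuFiltration_of_pos L α hp, ← poleFiltration_of_pos L h0 h1 hp]
      obtain ⟨-, -, hle, -⟩ := hpole
      exact hle p k hx
  · rcases le_or_gt p 0 with hp | hp
    · have hs : stupidFiltration K p = K := funext fun k => by
        rw [stupidFiltration, if_pos (by lia)]
      have ht : truncatedYuFiltration L α p = fun k : ℕ => L k k := funext fun k =>
        truncatedYuFiltration_of_nonpos L α hp k
      rw [hs, ht]
      refine ⟨fun x hx hx' => (hK _ _).2 ⟨h.mono (by simpa using h0) hx, ((hK _ _).1 hx').1⟩,
        fun k x hx hx' => ?_⟩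
      have hx'' := ((hK _ _).1 hx').1
      -- The reduction goes down to `0` instead of `α`, so that the primitive lies in `L k`. This is
      -- permitted because the differential is in `L α ⊆ L 1`.
      obtain ⟨ξ, hξ, hξ'⟩ := h.reduce_succ_nat (a := 0) (k + 1) (h.mono (by simp) hx)
        (h.mono (by linarith) hx'')
      refine ⟨ξ, h.mono (by simp) hξ, (hK _ _).2 ⟨h.mono h0 hξ', ?_⟩⟩
      rwa [map_sub, h.comp_eq_zero, sub_zero]
    · have ht : truncatedYuFiltration L α p = poleFiltration L α p := funext fun k => by
        rw [truncatedYuFiltration_of_pos L α hp, ← poleFiltration_of_pos L h0 h1 hp]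
      rw [ht]
      exact h.quotientExact_stupidFiltration_poleFiltration hK p

/-- Only `p = -N ≤ 0` requires an argument: `N` integral reductions, and then one that removes the
fractional excess `α`. -/
theorem isFilteredQuasiIso_truncatedYuFiltration_yuFiltration (h : HasPoleReduction δ L)
    (h0 : 0 ≤ α) (h1 : α < 1) :
    IsFilteredQuasiIso δ h.comp_eq_zero (truncatedYuFiltration L α) (yuFiltration L α) := by
  refine isFilteredQuasiIso_of_quotientExact δ _
    (h.isFiltration_truncatedYuFiltration h0 h1)
    (h.isFiltration_yuFiltration h0 h1) (fun p k => ?_) (fun p => ?_)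
  · rcases le_or_gt p 0 with hp | hp
    · rw [truncatedYuFiltration_of_nonpos L α hp, yuFiltration_eq L h0 h1, if_pos (by lia)]
      have : (p : ℝ) ≤ 0 := by exact_mod_cast hp
      exact h.le (by linarith) k
    · exact (truncatedYuFiltration_of_pos L α hp k).le
  · rcases le_or_gt p 0 with hp | hp
    · have ht : truncatedYuFiltration L α p = fun k : ℕ => L k k := funext fun k =>
        truncatedYuFiltration_of_nonpos L α hp k
      obtain ⟨N, rfl⟩ := Int.exists_eq_neg_ofNat hp
      have hy : yuFiltration L α (-(N : ℤ)) = fun k : ℕ => L ((k : ℝ) + α + N) k := funext fun k => by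
        rw [yuFiltration_eq L h0 h1, if_pos (by lia)]
        congr 1
        push_cast
        ring
      rw [ht, hy]
      constructor
      · intro x hx hx'
        have hx1 := h.reduce_zero_nat (a := α) N (h.mono (by simp) hx)
          (h.mono (by simpa using h0) hx')
        -- The last reduction goes from `α` to `0`, with `a = α - 1 ≤ b = 0`.
        exact h.reduce_zero (a := α - 1) (by push_cast; linarith) (h.mono (by simp) hx1)
          (h.mono (by simp) hx')
      · intro k x hx hx'
        obtain ⟨ξ, hξ, hξ'⟩ := h.reduce_succ_nat (a := (k : ℝ) + 1 + α) N
          (h.mono (by push_cast; linarith) hx) (h.mono (by push_cast; linarith) hx')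
        -- The fractional reduction, from `k + 1 + α` to `k + 1`, is where distinct indices `a ≤ b`
        -- are needed: the differential is only known to be in `L (k + 2)`.
        obtain ⟨ξ', hξ₁, ζ, hζ, hxζ⟩ := h.reduce_succ (a := (k : ℝ) + α) (b := (k : ℝ) + 1)
          (by linarith) (h.mono (by linarith) hξ') (by
            rw [map_sub, h.comp_eq_zero, sub_zero]
            exact h.mono (by push_cast; linarith) hx')
        refine ⟨ξ + ξ', Submodule.add_mem _ (h.mono (by linarith) hξ)
          (h.mono (by linarith [N.cast_nonneg (α := ℝ)]) hξ₁), ?_⟩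
        rw [map_add, ← sub_sub, hxζ, add_sub_cancel_left]
        exact h.mono (by push_cast; linarith) hζ
    · have ht : truncatedYuFiltration L α p = yuFiltration L α p := funext fun k =>
        truncatedYuFiltration_of_pos L α hp k
      rw [ht]
      exact quotientExact_refl _

end HasPoleReduction

end PoleFiltrations


/-! ### Meromorphic forms and logarithmic forms of bounded pole order -/

section Meromorphic

variable {n : ℕ} {S : Finset (Fin n)} {m : Fin n → ℤ} {k : ℕ}

theorem prod_zpow_natCast (N : ℕ) (z : Fin n → ℂ) :
    ∏ i ∈ S, z i ^ ((fun _ => (N : ℤ)) i : ℤ) = (∏ i ∈ S, z i) ^ N := by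
  simp [Finset.prod_pow]

theorem apply_logFrame (w : Form n k) (J : Fin k → Fin n) (z : Fin n → ℂ) :
    w (fun a => logFrame S z (J a)) =
      (∏ a, if J a ∈ S then z (J a) else 1) * w (fun a => Pi.single (J a) 1) := by
  have h : (fun a => logFrame S z (J a)) =
      fun a => (if J a ∈ S then z (J a) else 1) • (Pi.single (J a) 1 : Fin n → ℂ) := by
    ext a : 1
    rw [logFrame, ← Pi.single_smul, smul_eq_mul, mul_one]
  rw [h]
  exact w.toMultilinearMap.map_smul_univ _ _

theorem exists_mem_logForms_of_mem_meroForms {γ : HolForms S k} (h : γ ∈ meroForms S k) :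
    ∃ N : ℕ, γ ∈ logForms S (fun _ => (N : ℤ)) k := by
  obtain ⟨η, hη, N, θ, hθ, h⟩ := h
  refine ⟨N, η, hη, fun J => ⟨fun z => (∏ a, if J a ∈ S then z (J a) else 1) *
    θ z (fun a => Pi.single (J a) 1), AnalyticAt.mul ?_ ?_, ?_⟩⟩
  · refine Finset.analyticAt_fun_prod _ fun a _ => ?_
    by_cases ha : J a ∈ S
    · simpa only [ha, if_true] using analyticAt_coord (J a) 0
    · simpa only [ha, if_false] using analyticAt_const
  · have := @ContinuousLinearMap.analyticAt ℂ _ (Form n k) _ _ ℂ _ _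
      (ContinuousAlternatingMap.apply ℂ (Fin n → ℂ) ℂ (fun a => Pi.single (J a) 1)) (θ 0)
    exact this.comp (f := θ) (x := (0 : Fin n → ℂ)) hθ
  · filter_upwards [h] with z hz
    have hz' := congrArg (fun w : Form n k => w (fun a => Pi.single (J a) 1)) hz
    change (∏ i ∈ S, z i) ^ N * η z (fun a => Pi.single (J a) 1) = _ at hz'
    rw [prod_zpow_natCast, apply_logFrame, ← hz']
    ring

/-- The values of a form on the tuples of basis vectors. -/
def formCoefficients (n k : ℕ) : Form n k →ₗ[ℂ] ((Fin k → Fin n) → ℂ) where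
  toFun w J := w (fun a => Pi.single (J a) 1)
  map_add' _ _ := rfl
  map_smul' _ _ := rfl

theorem ker_formCoefficients (n k : ℕ) : LinearMap.ker (formCoefficients n k) = ⊥ := by
  refine LinearMap.ker_eq_bot'.2 fun w hw => ?_
  have : w.toMultilinearMap = 0 :=
    Module.Basis.ext_multilinear (fun _ => Pi.basisFun ℂ (Fin n)) fun J => by
      simpa [formCoefficients] using congrFun hw J
  ext v
  exact congrArg (fun g => g v) this

theorem exists_analyticAt_form {c : (Fin k → Fin n) → (Fin n → ℂ) → ℂ}
    (hc : ∀ J, AnalyticAt ℂ (c J) 0) :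
    ∃ θ : (Fin n → ℂ) → Form n k, AnalyticAt ℂ θ 0 ∧
      ∀ z (w : Form n k), (∀ J : Fin k → Fin n, w (fun a => Pi.single (J a) 1) = c J z) →
        w = θ z := by
  -- A linear left inverse of the coefficient map rebuilds the form from its coefficients, hence
  -- holomorphically.
  obtain ⟨Ψ, hΨ⟩ := (formCoefficients n k).exists_leftInverse_of_injective
    (ker_formCoefficients n k)
  refine ⟨fun z => Ψ fun J => c J z, ?_, fun z w hw => ?_⟩
  · have h1 := @ContinuousLinearMap.analyticAt ℂ _ ((Fin k → Fin n) → ℂ) _ _ (Form n k) _ _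
      (LinearMap.toContinuousLinearMap Ψ) (fun J => c J 0)
    exact h1.comp (f := fun z J => c J z) (x := (0 : Fin n → ℂ)) (AnalyticAt.pi hc)
  · change w = Ψ fun J => c J z
    rw [← show formCoefficients n k w = fun J => c J z from funext hw]
    exact (LinearMap.congr_fun hΨ w).symm

theorem logFun_inv_coord (j : Fin n) :
    LogFun S 1 (fun z => (if j ∈ S then z j else 1)⁻¹) := by
  by_cases hj : j ∈ S
  · have h := (logFun_prod_zpow (S := S) (fun i => if i = j then -1 else 0)).mono (m' := 1)
      fun i _ => by
        change -(if i = j then (-1 : ℤ) else 0) ≤ 1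
        split_ifs <;> simp
    refine h.congr (Eventually.of_forall fun z => ?_)
    simp only [hj, if_true]
    rw [Finset.prod_eq_single_of_mem j hj fun i _ hi => by simp [hi]]
    simp
  · simp only [hj, if_false]
    exact (LogFun.of_analyticAt analyticAt_const).mono fun i _ => by simp

theorem logFun_prod_inv_coord {l : ℕ} (J : Fin l → Fin n) :
    LogFun S (fun _ => (l : ℤ)) (fun z => (∏ a, if J a ∈ S then z (J a) else 1)⁻¹) := by
  induction l with
  | zero =>
    refine ((LogFun.of_analyticAt (S := S) (analyticAt_const (v := (1 : ℂ)))).mono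
      fun i _ => by simp).congr (Eventually.of_forall fun z => by simp)
  | succ l ih =>
    refine ((logFun_inv_coord (J 0)).mul (ih fun a => J a.succ)).mono (fun i _ => ?_) |>.congr
      (Eventually.of_forall fun z => ?_)
    · simp [add_comm]
    · simp only [Fin.prod_univ_succ, mul_inv]

theorem logForms_le_meroForms : logForms S m k ≤ meroForms S k := by
  rintro γ ⟨η, hη, h⟩
  -- Passing from the logarithmic frame to the `k` coordinate vectors costs a pole of order at most
  -- `k` along each hyperplane; the sum bounds every `m i` at once.
  set N : ℕ := k + ∑ i, (m i).toNat with hN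
  have hJ : ∀ J : Fin k → Fin n,
      LogFun S (fun _ => (N : ℤ)) (fun z => η z (fun a => Pi.single (J a) 1)) := by
    intro J
    refine ((logFun_prod_inv_coord J).mul (h J)).mono (fun i _ => ?_) |>.congr ?_
    · have h1 : (m i).toNat ≤ ∑ i, (m i).toNat :=
        Finset.single_le_sum (f := fun i => (m i).toNat) (fun _ _ => Nat.zero_le _)
          (Finset.mem_univ i)
      have h2 := Int.self_le_toNat (m i)
      change (k : ℤ) + m i ≤ (N : ℤ)
      lia
    · filter_upwards [eventually_mem_offHyperplanes] with z hz
      rw [apply_logFrame, inv_mul_cancel_left₀]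
      refine Finset.prod_ne_zero_iff.2 fun a _ => ?_
      split_ifs with ha
      · exact hz _ ha
      · exact one_ne_zero
  choose c hc hc' using hJ
  obtain ⟨θ, hθ, hθ'⟩ := exists_analyticAt_form hc
  refine ⟨η, hη, N, θ, hθ, ?_⟩
  filter_upwards [eventually_all.2 hc'] with z hz
  refine hθ' z _ fun J => ?_
  rw [← hz J, prod_zpow_natCast]
  rfl

variable {F : (Fin n → ℂ) → ℂ} (hF : ∀ᶠ z in nhdsOff S, AnalyticAt ℂ F z)

theorem isSubcomplex_meroForms {e : Fin n → ℤ} (hFe : LogFun S e F) (u v : ℂ) :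
    IsSubcomplex (M := fun k => HolForms S k) (twistedD S F hF u v) (meroForms S) := by
  intro k γ h
  obtain ⟨N, hN⟩ := exists_mem_logForms_of_mem_meroForms h
  rw [twistedD_apply]
  exact Submodule.add_mem _
    (Submodule.smul_mem _ _ (logForms_le_meroForms (extDeriv_mem_logForms hF hN)))
    (Submodule.smul_mem _ _ (logForms_le_meroForms (dF_mem_logForms hF hFe hN)))

theorem irregularHodge_le_meroForms (e : Fin n → ℕ) (α : ℝ) (p : ℤ) :
    irregularHodge S e α p k ≤ meroForms S k := by
  unfold irregularHodge FYu logPPlus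
  split_ifs
  · exact logForms_le_meroForms
  · exact bot_le

end Meromorphic

/-! ### The statements on a stalk, at poles of `f` and elsewhere -/

section Stalk

variable {n : ℕ} {S : Finset (Fin n)} {F : (Fin n → ℂ) → ℂ}
  (hF : ∀ᶠ z in nhdsOff S, AnalyticAt ℂ F z)

/-- The assertions of the main theorem on a stalk. -/
def StalkStatement (S : Finset (Fin n)) (e : Fin n → ℕ) (F : (Fin n → ℂ) → ℂ)
    (hF : ∀ᶠ z in nhdsOff S, AnalyticAt ℂ F z) : Prop :=
  (∀ (u : ℂ) (μ : ℝ), IsFilteredQuasiIso (M := fun k => HolForms S k) (twistedD S F hF u 1)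
      (twistedD_twistedD S F hF u 1) (sigma S e F hF μ) (tau S e μ)) ∧
    ∀ (u : ℂ) (α : ℝ), 0 ≤ α → α < 1 →
      IsFilteredQuasiIso (M := fun k => HolForms S k) (twistedD S F hF u 1)
        (twistedD_twistedD S F hF u 1) (sigma S e F hF α) (truncatedFYu S e α) ∧
      IsFilteredQuasiIso (M := fun k => HolForms S k) (twistedD S F hF u 1)
        (twistedD_twistedD S F hF u 1) (truncatedFYu S e α) (irregularHodge S e α)

theorem HasLogPole.hasPoleReduction {e : Fin n → ℕ} (hFe : HasLogPole S (fun i => (e i : ℤ)) F)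
    (u : ℂ) : HasPoleReduction (M := fun k => HolForms S k) (twistedD S F hF u 1) (logP S e) where
  comp_eq_zero := twistedD_twistedD S F hF u 1
  mono hab _ _ hx := logP_mono hab hx
  map_mem hx := twistedD_mem_logP hF u hFe.1 hx
  reduce_zero hab _ hx hx' := mem_logP_of_twistedD_mem hF u hFe hab hx hx'
  reduce_succ hab _ _ hx hx' := exists_eq_twistedD_add hF u hFe hab hx hx'

theorem HasLogPole.stalkStatement {e : Fin n → ℕ} (hFe : HasLogPole S (fun i => (e i : ℤ)) F) :
    StalkStatement S e F hF :=
  ⟨fun u _ => (hFe.hasPoleReduction hF u).isFilteredQuasiIso_stupidFiltration_poleFiltration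
      fun _ _ => mem_kontsevich_iff hF u,
    fun u _ h0 h1 => ⟨(hFe.hasPoleReduction
      hF u).isFilteredQuasiIso_stupidFiltration_truncatedYuFiltration h0 h1
      fun _ _ => mem_kontsevich_iff hF u,
    (hFe.hasPoleReduction hF u).isFilteredQuasiIso_truncatedYuFiltration_yuFiltration h0 h1⟩⟩

/-- Without poles all the `logP S e a` coincide and are stable by `df ∧`, so the four filtrations
are one and the same stupid filtration. -/
theorem stalkStatement_of_analyticAt {e : Fin n → ℕ} (he : ∀ i, e i = 0) (hF0 : LogFun S 0 F) :
    StalkStatement S e F hF := by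
  have hL : ∀ a, logP S e a = logP S e 0 := fun a => by
    ext k : 1
    simp [logP, he]
  have hK : ∀ μ, kontsevich S e F hF μ = logP S e 0 := fun μ => by
    ext k : 1
    rw [kontsevich, hL]
    refine inf_eq_left.2 fun γ hγ => ?_
    have h := dF_mem_logForms hF hF0 hγ
    rw [add_zero] at h
    exact h
  have hsub : ∀ u, IsSubcomplex (M := fun k => HolForms S k) (twistedD S F hF u 1)
      (logP S e 0) := fun u => by
    intro k γ hγ
    rw [← hK 0] at hγ
    exact ((mem_kontsevich_iff hF u).1 hγ).2
  have hσ : ∀ μ, sigma S e F hF μ = stupidFiltration (M := fun k => HolForms S k) (logP S e 0) :=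
    fun μ => by
      rw [← hK μ]
      rfl
  have hτ : ∀ μ, tau S e μ = stupidFiltration (M := fun k => HolForms S k) (logP S e 0) :=
    fun μ => by
      ext p k : 2
      simp only [tau, F0, stupidFiltration, hL]
      split_ifs <;> first | rfl | lia
  have hy : ∀ α : ℝ, 0 ≤ α → α < 1 → irregularHodge S e α =
      stupidFiltration (M := fun k => HolForms S k) (logP S e 0) := fun α h0 h1 => by
    ext p k : 2
    refine (yuFiltration_eq (M := fun k => HolForms S k) (logP S e) h0 h1 p k).trans ?_
    rw [hL]
    rfl
  have ht : ∀ α : ℝ, 0 ≤ α → α < 1 → truncatedFYu S e α =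
      stupidFiltration (M := fun k => HolForms S k) (logP S e 0) := fun α h0 h1 => by
    ext p k : 2
    rcases le_or_gt p 0 with hp | hp
    · refine (truncatedYuFiltration_of_nonpos (M := fun k => HolForms S k)
        (logP S e) α hp k).trans ?_
      rw [hL, stupidFiltration, if_pos (by lia)]
    · refine (truncatedYuFiltration_of_pos (M := fun k => HolForms S k)
        (logP S e) α hp k).trans ?_
      exact congrFun (congrFun (hy α h0 h1) p) k
  have hrefl := fun u => isFilteredQuasiIso_refl (M := fun k => HolForms S k)
    (twistedD_twistedD S F hF u 1) (isFiltration_stupidFiltration (hsub u))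
  refine ⟨fun u μ => ?_, fun u α h0 h1 => ⟨?_, ?_⟩⟩
  · rw [hσ, hτ]
    exact hrefl u
  · rw [hσ, ht α h0 h1]
    exact hrefl u
  · rw [ht α h0 h1, hy α h0 h1]
    exact hrefl u

end Stalk


/-! ### Holomorphic functions vanishing only on coordinate hyperplanes -/

section ParametricIntegral

variable {E G : Type*} [NormedAddCommGroup E] [NormedSpace ℂ E] [NormedAddCommGroup G]
  [NormedSpace ℂ G] [CompleteSpace G]

set_option maxHeartbeats 2000000 in
-- The power series of `g` is composed with `L t` and integrated term by term; as `‖L t‖ ≤ 1`, its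
-- coefficients do not grow and the radius is kept.
theorem analyticAt_intervalIntegral {g : E → G} (hg : AnalyticAt ℂ g 0) {L : ℝ → E →L[ℂ] E}
    (hL : Continuous L) (hL1 : ∀ t ∈ Set.Icc (0 : ℝ) 1, ‖L t‖ ≤ 1) :
    AnalyticAt ℂ (fun z => ∫ t in (0 : ℝ)..1, g (L t z)) 0 := by
  obtain ⟨p, r, hp⟩ := hg
  have hIoc : ∀ t ∈ Set.uIoc (0 : ℝ) 1, ‖L t‖ ≤ 1 := fun t ht => by
    rw [Set.uIoc_of_le zero_le_one] at ht
    exact hL1 t ⟨ht.1.le, ht.2⟩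
  let P : ∀ k, ℝ → E [×k]→L[ℂ] G := fun k t => (p k).compContinuousLinearMap fun _ => L t
  have hcont : ∀ k, Continuous (P k) := fun k =>
    (ContinuousMultilinearMap.compContinuousLinearMapLRight (p k)).cont.comp
      (continuous_pi fun _ => hL)
  obtain ⟨q, hqP⟩ : ∃ q : FormalMultilinearSeries ℂ E G,
      ∀ k, q k = ∫ t in (0 : ℝ)..1, P k t := ⟨fun k => ∫ t in (0 : ℝ)..1, P k t, fun _ => rfl⟩
  have hq : ∀ k, ‖q k‖ ≤ ‖p k‖ := fun k => by
    have h := intervalIntegral.norm_integral_le_of_norm_le_const (C := ‖p k‖) (f := P k)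
      (a := 0) (b := 1) fun t ht => by
        refine (ContinuousMultilinearMap.norm_compContinuousLinearMap_le _ _).trans ?_
        refine mul_le_of_le_one_right (norm_nonneg _) ?_
        exact Finset.prod_le_one (fun _ _ => norm_nonneg _) fun _ _ => hIoc t ht
    rw [hqP]
    simpa using h
  refine ⟨q, r, hp.r_le.trans (FormalMultilinearSeries.radius_le_of_le hq), hp.r_pos,
    fun {y} hy => ?_⟩
  have hqy : ∀ k, q k (fun _ => y) = ∫ t in (0 : ℝ)..1, p k (fun _ => L t y) := fun k => by
    rw [hqP]
    exact ((ContinuousMultilinearMap.apply ℂ (fun _ : Fin k => E) G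
      (fun _ => y)).intervalIntegral_comp_comm ((hcont k).intervalIntegrable 0 1)).symm
  have hLy : ∀ t ∈ Set.uIoc (0 : ℝ) 1, ‖L t y‖ ≤ ‖y‖ := fun t ht =>
    ((L t).le_opNorm y).trans (mul_le_of_le_one_left (norm_nonneg _) (hIoc t ht))
  have hyr : (‖y‖₊ : ENNReal) < r := by simpa [enorm] using hy
  have hsum : Summable fun k => ‖p k‖ * ‖y‖ ^ k :=
    p.summable_norm_mul_pow (hyr.trans_le hp.r_le)
  simp only [hqy, zero_add]
  refine intervalIntegral.hasSum_integral_of_dominated_convergence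
    (fun k _ => ‖p k‖ * ‖y‖ ^ k) (fun k => ?_) (fun k => ?_) ?_ ?_ ?_
  · have : Continuous fun t => p k (fun _ => L t y) :=
      (p k).cont.comp (continuous_pi fun _ => hL.clm_apply continuous_const)
    exact this.aestronglyMeasurable
  · refine Eventually.of_forall fun t ht => ((p k).le_opNorm _).trans ?_
    have : ‖L t y‖ ^ k ≤ ‖y‖ ^ k := pow_le_pow_left₀ (norm_nonneg _) (hLy t ht) k
    simpa using mul_le_mul_of_nonneg_left this (norm_nonneg (p k))
  · exact Eventually.of_forall fun _ _ => hsum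
  · exact intervalIntegrable_const
  · refine Eventually.of_forall fun t ht => ?_
    have h : L t y ∈ Metric.eball (0 : E) r := by
      refine lt_of_le_of_lt ?_ hyr
      simpa [enorm, ← NNReal.coe_le_coe] using hLy t ht
    simpa using hp.hasSum h

end ParametricIntegral

/-! ### Division by a coordinate -/

section Division

variable {n : ℕ}

/-- The multiplication of the `i`-th coordinate by `t`. -/
def scaleCoord (i : Fin n) (t : ℝ) : (Fin n → ℂ) →L[ℂ] (Fin n → ℂ) :=
  ContinuousLinearMap.id ℂ _ - (1 - (t : ℂ)) •
    (ContinuousLinearMap.single ℂ (fun _ : Fin n => ℂ) i).comp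
      (ContinuousLinearMap.proj (R := ℂ) (φ := fun _ : Fin n => ℂ) i)

theorem scaleCoord_apply (i : Fin n) (t : ℝ) (z : Fin n → ℂ) :
    scaleCoord i t z = Function.update z i (t * z i) := by
  ext j
  by_cases hj : j = i
  · subst hj
    simp [scaleCoord]
    ring
  · simp [scaleCoord, hj]

theorem scaleCoord_apply_eq_add (i : Fin n) (t : ℝ) (z : Fin n → ℂ) :
    scaleCoord i t z = z + ((t : ℂ) - 1) • Pi.single i (z i) := by
  ext j
  by_cases hj : j = i
  · subst hj
    simp [scaleCoord]
    ring
  · simp [scaleCoord, hj]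

theorem norm_scaleCoord_le (i : Fin n) {t : ℝ} (ht : t ∈ Set.Icc (0 : ℝ) 1) :
    ‖scaleCoord i t‖ ≤ 1 := by
  refine ContinuousLinearMap.opNorm_le_bound _ zero_le_one fun z => ?_
  rw [one_mul, scaleCoord_apply, pi_norm_le_iff_of_nonneg (norm_nonneg _)]
  intro j
  by_cases hj : j = i
  · subst hj
    rw [Function.update_self, norm_mul, Complex.norm_real, Real.norm_of_nonneg ht.1]
    exact (mul_le_of_le_one_left (norm_nonneg _) ht.2).trans (norm_le_pi_norm z j)
  · rw [Function.update_of_ne hj]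
    exact norm_le_pi_norm z j

theorem continuous_scaleCoord (i : Fin n) : Continuous (scaleCoord i) :=
  continuous_const.sub
    ((continuous_const.sub Complex.continuous_ofReal).smul continuous_const)

/-- Hadamard's lemma: the quotient is the integral over `t ∈ [0, 1]` of `∂h/∂z_i` at the point whose
`i`-th coordinate is multiplied by `t`. -/
theorem exists_eq_coord_mul {h : (Fin n → ℂ) → ℂ} (hh : AnalyticAt ℂ h 0) (i : Fin n)
    (h0 : ∀ᶠ z in 𝓝 (0 : Fin n → ℂ), z i = 0 → h z = 0) :
    ∃ h' : (Fin n → ℂ) → ℂ, AnalyticAt ℂ h' 0 ∧ ∀ᶠ z in 𝓝 0, h z = z i * h' z := by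
  let g : (Fin n → ℂ) → ℂ := fun z => fderiv ℂ h z (Pi.single i 1)
  have hg : AnalyticAt ℂ g 0 := analyticAt_clm_apply hh.fderiv analyticAt_const
  refine ⟨_, analyticAt_intervalIntegral hg (continuous_scaleCoord i)
    fun t ht => norm_scaleCoord_le i ht, ?_⟩
  obtain ⟨r, hr, hball⟩ := Metric.eventually_nhds_iff_ball.1 (h0.and hh.eventually_analyticAt)
  filter_upwards [Metric.ball_mem_nhds 0 hr] with z hz
  have hLz : ∀ t ∈ Set.Icc (0 : ℝ) 1, scaleCoord i t z ∈ Metric.ball (0 : Fin n → ℂ) r :=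
    fun t ht => by
      rw [mem_ball_zero_iff] at hz ⊢
      exact (((scaleCoord i t).le_opNorm z).trans
        (mul_le_of_le_one_left (norm_nonneg _) (norm_scaleCoord_le i ht))).trans_lt hz
  have hd : ∀ t ∈ Set.Icc (0 : ℝ) 1,
      HasDerivAt (fun t : ℝ => h (scaleCoord i t z)) (z i * g (scaleCoord i t z)) t := by
    intro t ht
    have h1 : HasDerivAt (fun s : ℂ => z + (s - 1) • (Pi.single i (z i) : Fin n → ℂ))
        (Pi.single i (z i)) (t : ℂ) := by
      simpa using (((hasDerivAt_id (t : ℂ)).sub_const 1).smul_const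
        (Pi.single i (z i) : Fin n → ℂ)).const_add z
    have h2 := (hball _ (hLz t ht)).2.differentiableAt.hasFDerivAt
    rw [scaleCoord_apply_eq_add] at h2
    have h3 := (h2.comp_hasDerivAt (t : ℂ) h1).comp_ofReal
    have h4 : (Pi.single i (z i) : Fin n → ℂ) = z i • Pi.single i 1 := by
      rw [← Pi.single_smul, smul_eq_mul, mul_one]
    simp only [scaleCoord_apply_eq_add]
    refine h3.congr_deriv ?_
    change _ = z i * fderiv ℂ h _ (Pi.single i 1)
    rw [h4, map_smul, smul_eq_mul]
  have hcont : ContinuousOn (fun t : ℝ => z i * g (scaleCoord i t z)) (Set.uIcc 0 1) := by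
    rw [Set.uIcc_of_le zero_le_one]
    refine continuousOn_const.mul fun t ht => ?_
    have h1 : ContinuousAt g (scaleCoord i t z) :=
      (analyticAt_clm_apply (hball _ (hLz t ht)).2.fderiv analyticAt_const).continuousAt
    have h2 : Continuous fun t => scaleCoord i t z :=
      (continuous_scaleCoord i).clm_apply continuous_const
    exact (ContinuousAt.comp (f := fun t => scaleCoord i t z) h1
      h2.continuousAt).continuousWithinAt
  have hint := intervalIntegral.integral_eq_sub_of_hasDerivAt
    (fun t ht => hd t (by rwa [Set.uIcc_of_le zero_le_one] at ht)) hcont.intervalIntegrable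
  have hz0 : h (scaleCoord i 0 z) = 0 :=
    (hball _ (hLz 0 (by simp))).1 (by simp [scaleCoord_apply])
  have hz1 : scaleCoord i 1 z = z := by simp [scaleCoord_apply]
  rw [hz0, hz1, sub_zero, intervalIntegral.integral_const_mul] at hint
  exact hint.symm

end Division


/-! ### Factorisation into a unit and a monomial, and its exponents -/

section UnitMonomial

variable {n : ℕ} {S : Finset (Fin n)}

theorem exists_maximal_coord_pow {g : (Fin n → ℂ) → ℂ} (hg : AnalyticAt ℂ g 0)
    (hg0 : ∀ᶠ z in nhdsOff S, g z ≠ 0) (i : Fin n) :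
    ∃ (m : ℕ) (h : (Fin n → ℂ) → ℂ), AnalyticAt ℂ h 0 ∧ (∀ᶠ z in 𝓝 0, g z = z i ^ m * h z) ∧
      ¬ ∀ᶠ z in 𝓝 (0 : Fin n → ℂ), z i = 0 → h z = 0 := by
  by_contra! H
  have hdiv : ∀ m : ℕ, ∃ h : (Fin n → ℂ) → ℂ, AnalyticAt ℂ h 0 ∧
      ∀ᶠ z in 𝓝 0, g z = z i ^ m * h z := by
    intro m
    induction m with
    | zero => exact ⟨g, hg, by simp⟩
    | succ m ih =>
      obtain ⟨h, hh, hgh⟩ := ih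
      obtain ⟨h', hh', hhh⟩ := exists_eq_coord_mul hh i (H m h hh hgh)
      refine ⟨h', hh', ?_⟩
      filter_upwards [hgh, hhh] with z h1 h2
      rw [h1, h2, pow_succ, mul_assoc]
  -- The diagonal meets the hyperplanes only at the origin. If every power of `z_i` divided `g`,
  -- then `g` would vanish to infinite order along it, contradicting `hg0`.
  let ι : ℂ →L[ℂ] (Fin n → ℂ) := ContinuousLinearMap.pi fun _ => ContinuousLinearMap.id ℂ ℂ
  have hι : ∀ t i, ι t i = t := fun _ _ => rfl
  have hι0 : ι 0 = 0 := map_zero ι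
  have han : ∀ {h : (Fin n → ℂ) → ℂ}, AnalyticAt ℂ h 0 → AnalyticAt ℂ (fun t => h (ι t)) 0 :=
    fun {h} hh => AnalyticAt.comp (f := ι) (by rwa [hι0]) (ι.analyticAt 0)
  have htend : Tendsto ι (𝓝 0) (𝓝 0) := by
    simpa only [hι0] using ι.continuous.tendsto 0
  have htop : analyticOrderAt (fun t => g (ι t)) 0 = ⊤ := by
    refine ENat.eq_top_iff_forall_ge.2 fun m => ?_
    obtain ⟨h, hh, hgh⟩ := hdiv m
    refine (natCast_le_analyticOrderAt (han hg)).2 ⟨_, han hh, ?_⟩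
    filter_upwards [htend.eventually hgh] with t ht
    simpa [hι] using ht
  have hzero := analyticOrderAt_eq_top.1 htop
  have hne : ∀ᶠ t in 𝓝[≠] (0 : ℂ), g (ι t) ≠ 0 := by
    refine (tendsto_nhdsWithin_iff.2 ⟨htend.mono_left nhdsWithin_le_nhds, ?_⟩ :
      Tendsto ι (𝓝[≠] 0) (nhdsOff S)).eventually hg0
    filter_upwards [self_mem_nhdsWithin] with t ht j _ using ht
  obtain ⟨t, h1, h2⟩ := (hne.and (hzero.filter_mono nhdsWithin_le_nhds)).exists
  exact h1 h2

theorem update_mem_ball {r : ℝ} {z : Fin n → ℂ} (hz : z ∈ Metric.ball (0 : Fin n → ℂ) r)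
    (i : Fin n) {ζ : ℂ} (hζ : ‖ζ‖ < r) : Function.update z i ζ ∈ Metric.ball (0 : Fin n → ℂ) r := by
  rw [mem_ball_zero_iff] at hz ⊢
  have hr : 0 < r := (norm_nonneg _).trans_lt hz
  rw [pi_norm_lt_iff hr] at hz ⊢
  intro j
  by_cases hj : j = i
  · subst hj
    simpa using hζ
  · simpa [hj] using hz j

theorem analyticAt_update_zero {h : (Fin n → ℂ) → ℂ} {z : Fin n → ℂ} {i : Fin n}
    (hh : AnalyticAt ℂ h (Function.update z i 0)) :
    AnalyticAt ℂ (fun w => h (Function.update w i 0)) z := by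
  have he : ∀ w : Fin n → ℂ, Function.update w i 0 = scaleCoord i 0 w := fun w => by
    simp [scaleCoord_apply]
  simp only [he] at hh ⊢
  exact AnalyticAt.comp hh ((scaleCoord i 0).analyticAt z)

/-- A holomorphic function on a polydisc which vanishes only on `z_i = 0`, `i ∈ insert i S`, and
does not vanish identically on `z_i = 0`, vanishes only on `z_j = 0`, `j ∈ S`. -/
theorem ne_zero_of_ne_zero_off_insert {h : (Fin n → ℂ) → ℂ} {i : Fin n} (hi : i ∉ S) {r : ℝ}
    (han : ∀ z ∈ Metric.ball (0 : Fin n → ℂ) r, AnalyticAt ℂ h z)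
    (hne : ∀ z ∈ Metric.ball (0 : Fin n → ℂ) r, z ∈ offHyperplanes S → z i ≠ 0 → h z ≠ 0)
    (hi0 : ¬ ∀ᶠ z in 𝓝 (0 : Fin n → ℂ), z i = 0 → h z = 0) {z : Fin n → ℂ}
    (hz : z ∈ Metric.ball (0 : Fin n → ℂ) r) (hzS : z ∈ offHyperplanes S) : h z ≠ 0 := by
  by_cases hzi : z i ≠ 0
  · exact hne z hz hzS hzi
  push Not at hzi
  intro hhz
  have hr : 0 < r := Metric.pos_of_mem_ball hz
  have hz0 : Function.update z i 0 = z := by rw [← hzi, Function.update_eq_self]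
  have hoff : ∀ {w : Fin n → ℂ} (ζ : ℂ), w ∈ offHyperplanes S →
      Function.update w i ζ ∈ offHyperplanes S := fun {w} ζ hw j hj => by
    rw [Function.update_of_ne (ne_of_mem_of_not_mem hj hi)]
    exact hw j hj
  -- Otherwise the identity principle on the ball would make `h` vanish on the whole of `z_i = 0`,
  -- against `hi0`.
  have hfreq : ∃ᶠ w in 𝓝 z, h (Function.update w i 0) ≠ 0 := by
    intro hev
    simp only [not_not] at hev
    have hU : AnalyticOnNhd ℂ (fun w => h (Function.update w i 0))
        (Metric.ball (0 : Fin n → ℂ) r) := fun w hw =>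
      analyticAt_update_zero (han _ (update_mem_ball hw i (by simpa using hr)))
    have heq := hU.eqOn_zero_of_preconnected_of_eventuallyEq_zero
      (convex_ball _ _).isPreconnected hz hev
    refine hi0 ?_
    filter_upwards [Metric.ball_mem_nhds 0 hr] with w hw hwi
    have hw' : h (Function.update w i 0) = 0 := heq hw
    rw [← hw', ← hwi, Function.update_eq_self]
  obtain ⟨ρ, hρ0, hρr⟩ := exists_between hr
  have hsph : ∀ ζ ∈ Metric.sphere (0 : ℂ) ρ, ζ ≠ 0 ∧ ‖ζ‖ < r := fun ζ hζ => by
    rw [mem_sphere_zero_iff_norm] at hζ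
    exact ⟨norm_pos_iff.1 (hζ ▸ hρ0), hζ ▸ hρr⟩
  have hcont : ∀ w ∈ Metric.ball (0 : Fin n → ℂ) r, ∀ ζ : ℂ, ‖ζ‖ < r →
      ContinuousAt (fun p : (Fin n → ℂ) × ℂ => ‖h (Function.update p.1 i p.2)‖) (w, ζ) := by
    intro w hw ζ hζ
    have h1 : Continuous fun p : (Fin n → ℂ) × ℂ => Function.update p.1 i p.2 :=
      continuous_fst.update i continuous_snd
    exact (ContinuousAt.comp (f := fun p : (Fin n → ℂ) × ℂ => Function.update p.1 i p.2)
      (han _ (update_mem_ball hw i hζ)).continuousAt h1.continuousAt).norm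
  obtain ⟨ζ₀, hζ₀, hmin⟩ := (isCompact_sphere (0 : ℂ) ρ).exists_isMinOn
    (NormedSpace.sphere_nonempty.2 hρ0.le) (f := fun ζ => ‖h (Function.update z i ζ)‖)
    fun ζ hζ => (ContinuousAt.comp (f := fun ζ : ℂ => (z, ζ)) (hcont z hz ζ (hsph ζ hζ).2)
      (by fun_prop)).continuousWithinAt
  have hpos : 0 < ‖h (Function.update z i ζ₀)‖ :=
    norm_pos_iff.2 (hne _ (update_mem_ball hz i (hsph _ hζ₀).2) (hoff _ hzS)
      (by simpa using (hsph _ hζ₀).1))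
  obtain ⟨δ, hδ0, hδ⟩ := exists_between hpos
  -- The lower bound for `h` on the circle through `z` persists on the nearby circles, by
  -- compactness.
  have htube : ∀ᶠ w in 𝓝 z, ∀ ζ ∈ Metric.sphere (0 : ℂ) ρ, δ < ‖h (Function.update w i ζ)‖ := by
    refine (isCompact_sphere (0 : ℂ) ρ).eventually_forall_of_forall_eventually fun ζ hζ => ?_
    exact (hcont z hz ζ (hsph ζ hζ).2).eventually
      (lt_mem_nhds (hδ.trans_le (hmin hζ)))
  have hsmall : ∀ᶠ w in 𝓝 z, ‖h (Function.update w i 0)‖ < δ := by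
    have h1 : ContinuousAt (fun w => ‖h (Function.update w i 0)‖) z :=
      ContinuousAt.comp (f := fun w : Fin n → ℂ => (w, (0 : ℂ)))
        (hcont z hz 0 (by simpa using hr)) (by fun_prop)
    refine h1.eventually (gt_mem_nhds ?_)
    simpa only [hz0, hhz, norm_zero] using hδ0
  have hmem : ∀ᶠ w in 𝓝 z, w ∈ Metric.ball (0 : Fin n → ℂ) r ∧ w ∈ offHyperplanes S :=
    (Metric.isOpen_ball.eventually_mem hz).and ((isOpen_offHyperplanes S).eventually_mem hzS)
  obtain ⟨w, hw0, hwδ, hwt, hwB, hwS⟩ :=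
    (hfreq.and_eventually (hsmall.and (htube.and hmem))).exists
  have hclosed : ∀ ζ ∈ Metric.closedBall (0 : ℂ) ρ, ‖ζ‖ < r := fun ζ hζ =>
    (mem_closedBall_zero_iff.1 hζ).trans_lt hρr
  have hnz : ∀ ζ ∈ Metric.closedBall (0 : ℂ) ρ, h (Function.update w i ζ) ≠ 0 := fun ζ hζ => by
    by_cases hζ0 : ζ = 0
    · rwa [hζ0]
    · exact hne _ (update_mem_ball hwB i (hclosed ζ hζ)) (hoff _ hwS) (by simpa using hζ0)
  have hdiff : DifferentiableOn ℂ (fun ζ => (h (Function.update w i ζ))⁻¹)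
      (Metric.closedBall (0 : ℂ) ρ) := fun ζ hζ =>
    (((han _ (update_mem_ball hwB i (hclosed ζ hζ))).differentiableAt.comp ζ
      (hasDerivAt_update w i ζ).differentiableAt).inv (hnz ζ hζ)).differentiableWithinAt
  -- The maximum principle for `1/h` on the disc through `w` gives `‖h‖ ≥ δ` at its centre, whereas
  -- `w` was chosen so near to the zero `z` that `‖h‖ < δ` there.
  have hmax := Complex.norm_le_of_forall_mem_frontier_norm_le (C := δ⁻¹) Metric.isBounded_ball
    (DifferentiableOn.diffContOnCl_ball (U := Metric.closedBall (0 : ℂ) ρ) hdiff subset_rfl)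
    (fun ζ hζ => by
      rw [frontier_ball _ hρ0.ne'] at hζ
      rw [norm_inv]
      exact inv_anti₀ hδ0 (hwt ζ hζ).le)
    (subset_closure (Metric.mem_ball_self hρ0))
  rw [norm_inv] at hmax
  exact absurd ((inv_le_inv₀ (norm_pos_iff.2 hw0) hδ0).1 hmax) (not_le.2 hwδ)

/-- A holomorphic germ which vanishes only on the coordinate hyperplanes `z_i = 0`, `i ∈ S`, is the
product of a monomial and of a unit. -/
theorem exists_unit_mul_monomial (S : Finset (Fin n)) {g : (Fin n → ℂ) → ℂ}
    (hg : AnalyticAt ℂ g 0) (hg0 : ∀ᶠ z in nhdsOff S, g z ≠ 0) :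
    ∃ (e : Fin n → ℕ) (w : (Fin n → ℂ) → ℂ), AnalyticAt ℂ w 0 ∧ w 0 ≠ 0 ∧
      ∀ᶠ z in 𝓝 0, g z = w z * ∏ i ∈ S, z i ^ e i := by
  induction S using Finset.induction_on generalizing g with
  | empty =>
    have : nhdsOff (∅ : Finset (Fin n)) = 𝓝 0 := by
      simp [nhdsOff, offHyperplanes]
    rw [this] at hg0
    exact ⟨0, g, hg, hg0.self_of_nhds, by simp⟩
  | insert i S hi ih =>
    -- Once the largest power of `z_i` is removed, the quotient has no zeros off the remaining
    -- hyperplanes, and the induction hypothesis applies to it.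
    obtain ⟨m, h, hh, hgh, hi0⟩ := exists_maximal_coord_pow hg hg0 i
    have hg0' := eventually_nhdsWithin_iff.1 hg0
    obtain ⟨r, hr, hball⟩ := Metric.eventually_nhds_iff_ball.1
      (hgh.and (hg0'.and hh.eventually_analyticAt))
    have hne : ∀ᶠ z in nhdsOff S, h z ≠ 0 := by
      filter_upwards [eventually_nhdsOff_of_nhds (Metric.ball_mem_nhds 0 hr),
        eventually_mem_offHyperplanes] with z hz hzS
      refine ne_zero_of_ne_zero_off_insert hi (fun z hz => (hball z hz).2.2)
        (fun z hz hzS hzi hhz => ?_) hi0 hz hzS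
      refine (hball z hz).2.1 (fun j hj => ?_) (by rw [(hball z hz).1, hhz, mul_zero])
      rcases Finset.mem_insert.1 hj with rfl | hj
      · exact hzi
      · exact hzS j hj
    obtain ⟨e, w, hw, hw0, hhw⟩ := ih hh hne
    refine ⟨Function.update e i m, w, hw, hw0, ?_⟩
    filter_upwards [hgh, hhw] with z h1 h2
    have hprod : ∏ j ∈ S, z j ^ Function.update e i m j = ∏ j ∈ S, z j ^ e j :=
      Finset.prod_congr rfl fun j hj => by
        rw [Function.update_of_ne (ne_of_mem_of_not_mem hj hi)]
    rw [h1, h2, Finset.prod_insert hi, Function.update_self, hprod]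
    ring

/-- If `m > e i`, cancelling `z_i ^ e i` and letting `z_i` tend to zero kills the right-hand side.
The left-hand side is nonzero at a point near the origin whose other coordinates are nonzero. -/
theorem le_of_unit_mul_monomial_eq {e : Fin n → ℕ} {w g : (Fin n → ℂ) → ℂ}
    (hw : AnalyticAt ℂ w 0) (hw0 : w 0 ≠ 0) (hg : AnalyticAt ℂ g 0) {i : Fin n} (hi : i ∈ S)
    {m : ℕ} (h : ∀ᶠ z in 𝓝 (0 : Fin n → ℂ), w z * ∏ j ∈ S, z j ^ e j = z i ^ m * g z) :
    m ≤ e i := by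
  by_contra! hlt
  let A : (Fin n → ℂ) → ℂ := fun z => w z * ∏ j ∈ S.erase i, z j ^ e j - z i ^ (m - e i) * g z
  have hA : AnalyticAt ℂ A 0 := (hw.mul (analyticAt_prod_pow _ _ _)).sub
    (((analyticAt_coord i 0).pow _).mul hg)
  obtain ⟨r, hr, hball⟩ := Metric.eventually_nhds_iff_ball.1
    (h.and (hA.eventually_analyticAt.and (hw.continuousAt.eventually_ne hw0)))
  let c : ℂ := ((r / 2 : ℝ) : ℂ)
  have hc : ‖c‖ < r := by
    rw [Complex.norm_real, Real.norm_of_nonneg (by linarith)]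
    linarith
  have hc0 : c ≠ 0 := by
    simp only [c, ne_eq, Complex.ofReal_eq_zero]
    linarith
  let z : Fin n → ℂ := fun _ => c
  have hz : z ∈ Metric.ball (0 : Fin n → ℂ) r := by
    rw [mem_ball_zero_iff, pi_norm_lt_iff hr]
    exact fun _ => hc
  have hA0 : ∀ᶠ ζ in 𝓝[≠] (0 : ℂ), A (Function.update z i ζ) = 0 := by
    filter_upwards [self_mem_nhdsWithin, mem_nhdsWithin_of_mem_nhds (Metric.ball_mem_nhds 0 hr)]
      with ζ hζ hζr
    have h1 := (hball _ (update_mem_ball hz i (mem_ball_zero_iff.1 hζr))).1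
    rw [← Finset.mul_prod_erase S _ hi, ← Nat.add_sub_of_le hlt.le, pow_add] at h1
    simp only [Function.update_self] at h1
    have h2 : ζ ^ e i ≠ 0 := pow_ne_zero _ hζ
    refine (mul_eq_zero.1 (?_ : ζ ^ e i * A (Function.update z i ζ) = 0)).resolve_left h2
    simp only [A, Function.update_self]
    linear_combination h1
  have hA1 : A (Function.update z i 0) = 0 := by
    have h1 : ContinuousAt (fun ζ : ℂ => A (Function.update z i ζ)) 0 :=
      ContinuousAt.comp (f := fun ζ : ℂ => Function.update z i ζ)
        (hball _ (update_mem_ball hz i (by simpa using hr))).2.1.continuousAt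
        (continuous_const.update i continuous_id).continuousAt
    exact tendsto_nhds_unique (h1.tendsto.mono_left nhdsWithin_le_nhds)
      (tendsto_const_nhds.congr' (hA0.mono fun _ h => h.symm))
  have h3 : m - e i ≠ 0 := by lia
  simp only [A, Function.update_self, zero_pow h3, zero_mul, sub_zero] at hA1
  rcases mul_eq_zero.1 hA1 with h4 | h4
  · exact (hball _ (update_mem_ball hz i (by simpa using hr))).2.2 h4
  · obtain ⟨j, hj, hj'⟩ := Finset.prod_eq_zero_iff.1 h4
    rw [Function.update_of_ne (Finset.ne_of_mem_erase hj)] at hj'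
    exact hc0 (eq_zero_of_pow_eq_zero hj')

theorem sSup_coord_pow_dvd {e : Fin n → ℕ} {w g : (Fin n → ℂ) → ℂ} (hw : AnalyticAt ℂ w 0)
    (hw0 : w 0 ≠ 0) (hg : ∀ᶠ z in 𝓝 0, g z = w z * ∏ i ∈ S, z i ^ e i) {i : Fin n} (hi : i ∈ S) :
    sSup {m : ℕ | ∃ h : (Fin n → ℂ) → ℂ, AnalyticAt ℂ h 0 ∧ ∀ᶠ z in 𝓝 0, g z = z i ^ m * h z} =
      e i := by
  -- A greatest element is exhibited, since `sSup` of an unbounded set of natural numbers would be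
  -- the default value `0`.
  refine IsGreatest.csSup_eq ⟨⟨fun z => w z * ∏ j ∈ S.erase i, z j ^ e j,
    hw.mul (analyticAt_prod_pow _ _ _), ?_⟩, ?_⟩
  · filter_upwards [hg] with z hz
    rw [hz, ← Finset.mul_prod_erase S _ hi]
    ring
  · rintro m ⟨h, hh, hgh⟩
    refine le_of_unit_mul_monomial_eq hw hw0 hh hi ?_
    filter_upwards [hg, hgh] with z h1 h2
    rw [← h1, h2]

end UnitMonomial


/-! ### From the map to `ℙ¹` to the local model -/

/-! ### The local expression of the map in an adapted chart -/

section Chart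

variable {n : ℕ} {X : Type*} [TopologicalSpace X] [ChartedSpace (Fin n → ℂ) X]
  {D : Set X} {x : X} (c : NCChart n D x) {f : X → OnePoint ℂ}

theorem NCChart.zero_mem_target : (0 : Fin n → ℂ) ∈ c.chart.target :=
  c.map_eq_zero ▸ c.chart.map_source c.mem_source

theorem NCChart.symm_zero : c.chart.symm 0 = x := by
  rw [← c.map_eq_zero, c.chart.left_inv c.mem_source]

theorem NCChart.analyticAt_comp_symm {g : X → ℂ} {z : Fin n → ℂ} (hz : z ∈ c.chart.target)
    (hg : ContMDiffAt 𝓘(ℂ, Fin n → ℂ) 𝓘(ℂ, ℂ) ω g (c.chart.symm z)) :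
    AnalyticAt ℂ (fun z => g (c.chart.symm z)) z := by
  have h : ContMDiffAt 𝓘(ℂ, Fin n → ℂ) 𝓘(ℂ, Fin n → ℂ) ω c.chart.symm z :=
    (contMDiffOn_symm_of_mem_maximalAtlas c.mem_maximalAtlas).contMDiffAt
      (c.chart.open_target.mem_nhds hz)
  exact (hg.comp z h).contDiffAt.analyticAt

theorem NCChart.analyticAt_localF_zero (hf : IsHolomorphicToP1 n f) (hx : f x ≠ OnePoint.infty) :
    AnalyticAt ℂ (c.localF f) 0 :=
  c.analyticAt_comp_symm c.zero_mem_target (hf.contMDiffAt_coordT _ (by rwa [c.symm_zero]))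

theorem NCChart.analyticAt_localInvF_zero (hf : IsHolomorphicToP1 n f)
    (hx : f x = OnePoint.infty) : AnalyticAt ℂ (c.localInvF f) 0 :=
  c.analyticAt_comp_symm c.zero_mem_target
    (hf.contMDiffAt_coordT' _ (by rw [c.symm_zero, hx]; exact OnePoint.infty_ne_coe 0))

theorem NCChart.localF_mul_localInvF (hf : IsHolomorphicToP1 n f)
    (hfD : ∀ y, y ∉ D → f y ≠ OnePoint.infty) (hx : f x = OnePoint.infty) :
    ∀ᶠ z in nhdsOff c.S, c.localF f z * c.localInvF f z = 1 := by
  have hcont : ContinuousAt (fun z => f (c.chart.symm z)) 0 :=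
    ContinuousAt.comp (f := c.chart.symm) hf.continuous.continuousAt
      (c.chart.continuousAt_symm c.zero_mem_target)
  have hne : ∀ᶠ z in 𝓝 (0 : Fin n → ℂ), f (c.chart.symm z) ≠ ((0 : ℂ) : OnePoint ℂ) :=
    hcont.eventually_ne (by rw [c.symm_zero, hx]; exact OnePoint.infty_ne_coe 0)
  filter_upwards [eventually_nhdsOff_of_nhds hne,
    eventually_nhdsOff_of_nhds (c.chart.open_target.mem_nhds c.zero_mem_target),
    eventually_mem_offHyperplanes] with z h0 hz hzS
  have hD : c.chart.symm z ∉ D := by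
    rw [c.mem_iff _ (c.chart.map_target hz), c.chart.right_inv hz]
    rintro ⟨i, hi, h⟩
    exact hzS i hi h
  have hinf := hfD _ hD
  unfold NCChart.localF NCChart.localInvF
  obtain ⟨t, ht⟩ := OnePoint.ne_infty_iff_exists.1 hinf
  rw [← ht] at h0 ⊢
  have ht0 : t ≠ 0 := fun h => h0 (by rw [h])
  exact mul_inv_cancel₀ ht0

theorem NCChart.hasLogPole (hf : IsHolomorphicToP1 n f)
    (hfD : ∀ y, y ∉ D → f y ≠ OnePoint.infty) (hx : f x = OnePoint.infty) :
    HasLogPole c.S (fun i => (c.mult f i : ℤ)) (c.localF f) := by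
  have hmul := c.localF_mul_localInvF hf hfD hx
  obtain ⟨e, w, hw, hw0, hg⟩ := exists_unit_mul_monomial c.S (c.analyticAt_localInvF_zero hf hx)
    (hmul.mono fun z hz h0 => by simp [h0] at hz)
  have hmult : ∀ i ∈ c.S, c.mult f i = e i := fun i hi => by
    rw [NCChart.mult, if_pos hx]
    exact sSup_coord_pow_dvd hw hw0 hg hi
  have h0 : c.localInvF f 0 = 0 := by
    rw [NCChart.localInvF, c.symm_zero, hx]
    rfl
  -- Because `1/f` vanishes at `x`, its monomial is not constant; such an `i` gives the vector field
  -- of the homotopy.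
  obtain ⟨i, hi, hei⟩ : ∃ i ∈ c.S, e i ≠ 0 := by
    have h1 := hg.self_of_nhds
    rw [h0, eq_comm, mul_eq_zero, or_iff_right hw0] at h1
    obtain ⟨i, hi, h2⟩ := Finset.prod_eq_zero_iff.1 h1
    exact ⟨i, hi, fun h => by simp [h] at h2⟩
  refine hasLogPole_of_eq (hw.inv hw0) (inv_ne_zero hw0) hi
    (by rw [hmult i hi]; exact_mod_cast hei) ?_
  filter_upwards [hmul, eventually_nhdsOff_of_nhds hg] with z h1 h2
  rw [Finset.prod_congr rfl fun i hi => by rw [hmult i hi, zpow_natCast]]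
  rw [h2] at h1
  change _ = (w z)⁻¹
  refine eq_inv_of_mul_eq_one_left ?_
  linear_combination h1

theorem NCChart.stalkStatement (hf : IsHolomorphicToP1 n f)
    (hfD : ∀ y, y ∉ D → f y ≠ OnePoint.infty) :
    StalkStatement c.S (c.mult f) (c.localF f) (c.analyticAt_localF f hf hfD) := by
  by_cases hx : f x = OnePoint.infty
  · exact (c.hasLogPole hf hfD hx).stalkStatement _
  · exact stalkStatement_of_analyticAt _ (fun i => by rw [NCChart.mult, if_neg hx])
      (LogFun.of_analyticAt (c.analyticAt_localF_zero hf hx))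

theorem NCChart.isSubcomplex_meroForms (hf : IsHolomorphicToP1 n f)
    (hfD : ∀ y, y ∉ D → f y ≠ OnePoint.infty) (u v : ℂ) :
    IsSubcomplex (M := fun k => HolForms c.S k) (c.diff f hf hfD u v) (meroForms c.S) := by
  by_cases hx : f x = OnePoint.infty
  · exact KontsevichYu.isSubcomplex_meroForms (c.analyticAt_localF f hf hfD) (c.hasLogPole hf hfD hx).1 u v
  · exact KontsevichYu.isSubcomplex_meroForms (c.analyticAt_localF f hf hfD)
      (LogFun.of_analyticAt (c.analyticAt_localF_zero hf hx)) u v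

end Chart

end

end KontsevichYu


/-! ### The main theorem -/

theorem mainTheorem11 {n : ℕ} {X : Type*} [TopologicalSpace X] [ChartedSpace (Fin n → ℂ) X]
    [IsManifold 𝓘(ℂ, Fin n → ℂ) ω X] (D : Set X) (hD : KontsevichYu.IsNormalCrossing n D)
    (f : X → OnePoint ℂ) (hf : KontsevichYu.IsHolomorphicToP1 n f)
    (hfD : ∀ y, y ∉ D → f y ≠ OnePoint.infty) :
    ∀ (x : X) (c : KontsevichYu.NCChart n D x),
    (∀ μ : ℝ,
      c.IsFilteredQuasiIso f hf hfD 1 1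
        (KontsevichYu.sigma c.S (c.mult f) (c.localF f) (c.analyticAt_localF f hf hfD) μ)
        (KontsevichYu.tau c.S (c.mult f) μ) ∧
      c.IsFilteredQuasiIso f hf hfD 0 1
        (KontsevichYu.sigma c.S (c.mult f) (c.localF f) (c.analyticAt_localF f hf hfD) μ)
        (KontsevichYu.tau c.S (c.mult f) μ)) ∧
    (∀ α : ℝ, 0 ≤ α → α < 1 →
      c.IsFilteredQuasiIso f hf hfD 1 1
        (KontsevichYu.sigma c.S (c.mult f) (c.localF f) (c.analyticAt_localF f hf hfD) α)
        (KontsevichYu.truncatedFYu c.S (c.mult f) α) ∧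
      c.IsFilteredQuasiIso f hf hfD 1 1
        (KontsevichYu.truncatedFYu c.S (c.mult f) α)
        (KontsevichYu.irregularHodge c.S (c.mult f) α) ∧
      KontsevichYu.IsSubcomplex (M := fun k => KontsevichYu.HolForms c.S k)
        (c.diff f hf hfD 1 1) (KontsevichYu.meroForms c.S) ∧
      ∀ p k, KontsevichYu.irregularHodge c.S (c.mult f) α p k ≤ KontsevichYu.meroForms c.S k) := by
  intro x c
  obtain ⟨h₁, h₂⟩ := c.stalkStatement hf hfD
  exact ⟨fun μ => ⟨h₁ 1 μ, h₁ 0 μ⟩, fun α h0 h1 => ⟨(h₂ 1 α h0 h1).1, (h₂ 1 α h0 h1).2,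
    c.isSubcomplex_meroForms hf hfD 1 1,
    fun p _ => KontsevichYu.irregularHodge_le_meroForms (c.mult f) α p⟩⟩
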